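/- Let $\mathcal{T_M}$ be the following theory of bounded metric spaces in all finite types over two base types, $0$ (natural numbers) and $X$ (an abstract space). It is based on classical many-sorted predicate logic. Its constants are zero, successor, the combinators, Gödel's primitive recursors (for all these types), $d$ of type $X\to(X\to 1)$ and $b$ of type $0$, where $1$ denotes the type $0\to 0$. The only relation symbol is $=_0$. Functions of type $1$ represent real numbers by signed digits, $\gamma_{\mathbb R}$ being the representation associated with $\gamma$; $=_{\mathbb R}$ and $\leq_{\mathbb R}$ are $\Pi^0_1$-relations and $<_{\mathbb R}$ is a $\Sigma^0_1$-relation between representations. One defines $x=_X y$ as $d(x,y)=_{\mathbb R}0$, and equality of higher types pointwise. The axioms and rules are those of $=_0$, Spector's weak extensionality rule (for quantifier-free antecedents), the successor, combinator and recursor axioms, full induction, $d(x,y)(n)=_0 d(x,y)_{\mathbb R}(n)$, and $d(x,x)=_{\mathbb R}0$, $d(x,y)=_{\mathbb R}d(y,x)$, $d(x,z)\leq_{\mathbb R}d(x,y)+d(y,z)$, $d(x,y)\leq_{\mathbb R} b_{\mathbb R}$. Bounded formulas are built from atomic formulas by propositional connectives and the bounded quantifiers $\forall k\leq_0 t$,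 $\exists k\leq_0 t$, $\forall x^X$, $\exists x^X$, $\forall\gamma\in[0,1]$, $\exists\gamma\in[0,1]$, where $\forall\gamma\in[0,1]\,A(\gamma)$ stands for $\forall\gamma^1 A(\max(0,\min(1,\gamma_{\mathbb R})))$, and similarly for $\exists$. A $\Sigma$-formula is a formula $\exists n^0B$ with $B$ bounded. The theory $\mathcal{T_M}^+$ is $\mathcal{T_M}$ together with the following principles for all $\Sigma$-formulas $A$ (with parameters), where $\tilde f(n)=\max_{k\leq n}f(k)$: bounded choice $\forall n^0\exists k^0A(n,k)\to\exists f^1\forall n\,\exists k\leq\tilde f(n)\,A(n,k)$ and the bounded collection principles $\forall i\leq m\,\exists n^0A(i,n)\to\exists n\,\forall i\leq m\,\exists k\leq n\,A(i,k)$, $\forall\gamma\in[0,1]\,\exists n^0A(\gamma,n)\to\exists n\,\forall\gamma\in[0,1]\,\exists k\leq n\,A(\gamma,k)$, $\forall x^X\exists n^0A(x,n)\to\exists n\,\forall x^X\exists k\leq n\,A(x,k)$. Proposition 4.2 (General principle): The theory $\mathcal{T_M}^+$ proves the following (formalized) statement. Let $U$ be a map from $X$ to $X$, $\varphi$ a map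 from $X\times X$ to $\mathbb R$ (a functional of type $X\to(X\to 1)$), and $(u_n)_{n\in\mathbb N}$ a sequence of elements of $X$ such that $\lim_n d(U(u_n),u_n)=0$. Let $F$ be the collection of all $x$ with $U(x)=_X x$. If $\forall k\in\mathbb N\;\exists x\in F\;\forall y\in F\;\Big(\varphi(x,x)<\varphi(x,y)+\frac1{k+1}\Big)$, then $\forall k\in\mathbb N\;\exists x\in F\;\exists n\in\mathbb N\;\forall m\geq n\;\Big(\varphi(x,x)<\varphi(x,u_m)+\frac1{k+1}\Big)$. In ordinary mathematics the same statement is false, even for the closed unit ball $X$ of $\ell^1$: there are a continuous map $U:X\to X$, a bounded continuous function $\varphi:X\times X\to\mathbb R$ and a sequence $(u_n)$ in $X$ that satisfy both hypotheses but not the conclusion. -/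

import Mathlib

/-! The theory `T_M⁺` of bounded metric spaces in all finite types over the two base types `0`
(natural numbers) and `X` (an abstract metric space): types, terms, formulas, derivations,
signed digit representation of real numbers, the axioms, and the characteristic principles
`bAC` (bounded choice) and `bC` (bounded collection). -/

namespace BMS

/-- The finite types over the base types `0` (written `nat`) and `X`. -/
inductive Ty : Type
  | nat : Ty
  | X : Ty
  | arr : Ty → Ty → Ty

infixr:60 " ⇾ " => Ty.arr

/-- The type `1`, that is `0 → 0`. -/
abbrev Ty.one : Ty := Ty.nat ⇾ Ty.nat

/-- Typed de Bruijn variables: `Var Γ ρ` is the type of positions of `ρ` in the list `Γ`. -/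
inductive Var : List Ty → Ty → Type
  | zero {Γ : List Ty} {ρ : Ty} : Var (ρ :: Γ) ρ
  | succ {Γ : List Ty} {ρ σ : Ty} : Var Γ ρ → Var (σ :: Γ) ρ

/-- The constants: zero, successor, the combinators, the recursors of Gödel's `T` (for all
finite types over `0` and `X`), the distance function and the bound of the diameter. -/
inductive Const : Ty → Type
  | zero : Const Ty.nat
  | succ : Const (Ty.nat ⇾ Ty.nat)
  | comK (ρ τ : Ty) : Const (ρ ⇾ τ ⇾ ρ)
  | comS (ρ σ τ : Ty) : Const ((ρ ⇾ σ ⇾ τ) ⇾ (ρ ⇾ σ) ⇾ ρ ⇾ τ)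
  | recr (ρ : Ty) : Const (Ty.nat ⇾ ρ ⇾ (ρ ⇾ Ty.nat ⇾ ρ) ⇾ ρ)
  | dist : Const (Ty.X ⇾ Ty.X ⇾ Ty.one)
  | bound : Const Ty.nat

/-- Terms with free variables in `Γ`. There are no binders in terms. -/
inductive Tm (Γ : List Ty) : Ty → Type
  | var {ρ : Ty} : Var Γ ρ → Tm Γ ρ
  | const {ρ : Ty} : Const ρ → Tm Γ ρ
  | app {ρ τ : Ty} : Tm Γ (ρ ⇾ τ) → Tm Γ ρ → Tm Γ τ

infixl:75 " ⬝ " => Tm.app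

/-- Simultaneous substitutions of terms over `Δ` for the variables in `Γ`. -/
abbrev Sub (Γ Δ : List Ty) : Type := (ρ : Ty) → Var Γ ρ → Tm Δ ρ

def Tm.subst {Γ Δ : List Ty} (f : Sub Γ Δ) : {ρ : Ty} → Tm Γ ρ → Tm Δ ρ
  | _, .var x => f _ x
  | _, .const c => .const c
  | _, .app s t => .app (s.subst f) (t.subst f)

/-- The weakening substitution. -/
def Sub.shift {Γ : List Ty} {σ : Ty} : Sub Γ (σ :: Γ) := fun _ x => .var x.succ

def Tm.wk {Γ : List Ty} {σ ρ : Ty} (t : Tm Γ ρ) : Tm (σ :: Γ) ρ := t.subst Sub.shift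

/-- The extension of a substitution by a term for the last variable. -/
def Sub.cons {Γ Δ : List Ty} {σ : Ty} (t : Tm Δ σ) (f : Sub Γ Δ) : Sub (σ :: Γ) Δ
  | _, .zero => t
  | _, .succ x => f _ x

/-- The extension of a substitution that goes under a quantifier. -/
def Sub.lift {Γ Δ : List Ty} {σ : Ty} (f : Sub Γ Δ) : Sub (σ :: Γ) (σ :: Δ) :=
  Sub.cons (.var .zero) (fun ρ x => (f ρ x).wk)

/-- The substitution of `t` for the last variable. -/
def Sub.single {Γ : List Ty} {σ : Ty} (t : Tm Γ σ) : Sub (σ :: Γ) Γ :=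
  Sub.cons t (fun _ x => .var x)

def Tm.inst {Γ : List Ty} {σ ρ : Ty} (r : Tm (σ :: Γ) ρ) (t : Tm Γ σ) : Tm Γ ρ :=
  r.subst (Sub.single t)

/-- Formulas with free variables in `Γ`. The only relation symbol is equality of type `0`. -/
inductive Fm : List Ty → Type
  | eq {Γ : List Ty} : Tm Γ Ty.nat → Tm Γ Ty.nat → Fm Γ
  | bot {Γ : List Ty} : Fm Γ
  | and {Γ : List Ty} : Fm Γ → Fm Γ → Fm Γ
  | or {Γ : List Ty} : Fm Γ → Fm Γ → Fm Γ
  | imp {Γ : List Ty} : Fm Γ → Fm Γ → Fm Γ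
  | all {Γ : List Ty} (ρ : Ty) : Fm (ρ :: Γ) → Fm Γ
  | ex {Γ : List Ty} (ρ : Ty) : Fm (ρ :: Γ) → Fm Γ

infixr:40 " ⟹ " => Fm.imp
infixr:50 " ⋏ " => Fm.and
infix:60 " ≐ " => Fm.eq

def Fm.neg {Γ : List Ty} (A : Fm Γ) : Fm Γ := A ⟹ Fm.bot

def Fm.subst : {Γ Δ : List Ty} → Sub Γ Δ → Fm Γ → Fm Δ
  | _, _, f, .eq s t => .eq (s.subst f) (t.subst f)
  | _, _, _, .bot => .bot
  | _, _, f, .and A B => .and (A.subst f) (B.subst f)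
  | _, _, f, .or A B => .or (A.subst f) (B.subst f)
  | _, _, f, .imp A B => .imp (A.subst f) (B.subst f)
  | _, _, f, .all ρ A => .all ρ (A.subst f.lift)
  | _, _, f, .ex ρ A => .ex ρ (A.subst f.lift)

def Fm.wk {Γ : List Ty} {σ : Ty} (A : Fm Γ) : Fm (σ :: Γ) := A.subst Sub.shift

def Fm.inst {Γ : List Ty} {σ : Ty} (A : Fm (σ :: Γ)) (t : Tm Γ σ) : Fm Γ :=
  A.subst (Sub.single t)

/-- Quantifier-free formulas. -/
inductive Fm.QF : {Γ : List Ty} → Fm Γ → Prop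
  | eq {Γ : List Ty} (s t : Tm Γ Ty.nat) : QF (.eq s t)
  | bot {Γ : List Ty} : QF (.bot : Fm Γ)
  | and {Γ : List Ty} {A B : Fm Γ} : QF A → QF B → QF (.and A B)
  | or {Γ : List Ty} {A B : Fm Γ} : QF A → QF B → QF (.or A B)
  | imp {Γ : List Ty} {A B : Fm Γ} : QF A → QF B → QF (.imp A B)

/-! ### Closed terms -/

section Terms
variable {Γ : List Ty}

/-- The last seven variables, `v0` being the innermost one. -/
abbrev v0 {a : Ty} : Tm (a :: Γ) a := .var .zero
abbrev v1 {a b : Ty} : Tm (a :: b :: Γ) b := .var (.succ .zero)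
abbrev v2 {a b c : Ty} : Tm (a :: b :: c :: Γ) c := .var (.succ (.succ .zero))
abbrev v3 {a b c d : Ty} : Tm (a :: b :: c :: d :: Γ) d := .var (.succ (.succ (.succ .zero)))
abbrev v4 {a b c d e : Ty} : Tm (a :: b :: c :: d :: e :: Γ) e :=
  .var (.succ (.succ (.succ (.succ .zero))))
abbrev v5 {a b c d e f : Ty} : Tm (a :: b :: c :: d :: e :: f :: Γ) f :=
  .var (.succ (.succ (.succ (.succ (.succ .zero)))))
abbrev v6 {a b c d e f g : Ty} : Tm (a :: b :: c :: d :: e :: f :: g :: Γ) g :=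
  .var (.succ (.succ (.succ (.succ (.succ (.succ .zero))))))

abbrev comK {ρ τ : Ty} : Tm Γ (ρ ⇾ τ ⇾ ρ) := .const (.comK ρ τ)
abbrev comS {ρ σ τ : Ty} : Tm Γ ((ρ ⇾ σ ⇾ τ) ⇾ (ρ ⇾ σ) ⇾ ρ ⇾ τ) := .const (.comS ρ σ τ)
abbrev zero : Tm Γ Ty.nat := .const .zero
abbrev suc (t : Tm Γ Ty.nat) : Tm Γ Ty.nat := .const .succ ⬝ t
/-- `recr n y z` is `y` for `n = 0` and `z (recr m y z) m` for `n = m + 1`. -/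
abbrev recr {ρ : Ty} (n : Tm Γ Ty.nat) (y : Tm Γ ρ) (z : Tm Γ (ρ ⇾ Ty.nat ⇾ ρ)) : Tm Γ ρ :=
  .const (.recr ρ) ⬝ n ⬝ y ⬝ z

/-- `t` as a term without the last variable, if that variable does not occur in `t`. -/
def Tm.strengthen {σ : Ty} : {τ : Ty} → Tm (σ :: Γ) τ → Option (Tm Γ τ)
  | _, .var .zero => none
  | _, .var (.succ x) => some (.var x)
  | _, .const c => some (.const c)
  | _, .app s t =>
    match s.strengthen, t.strengthen with
    | some s', some t' => some (s' ⬝ t')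
    | _, _ => none

/-- Combinatory abstraction of the last variable. -/
def lam {σ : Ty} : {τ : Ty} → Tm (σ :: Γ) τ → Tm Γ (σ ⇾ τ)
  | _, .var .zero => comS ⬝ comK ⬝ (comK (τ := σ))
  | _, .var (.succ x) => comK ⬝ .var x
  | _, .const c => comK ⬝ .const c
  | _, .app s t =>
    match s.strengthen, t.strengthen with
    | some s', some t' => comK ⬝ (s' ⬝ t')
    | _, _ => comS ⬝ lam s ⬝ lam t

def num : ℕ → Tm Γ Ty.nat
  | 0 => zero
  | n + 1 => suc (num n)

/-- Addition of natural numbers. -/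
def addC : Tm Γ (Ty.nat ⇾ Ty.nat ⇾ Ty.nat) := lam (lam (recr v0 v1 (lam (lam (suc v1)))))
def add (s t : Tm Γ Ty.nat) : Tm Γ Ty.nat := addC ⬝ s ⬝ t

/-- Predecessor. -/
def predC : Tm Γ (Ty.nat ⇾ Ty.nat) := lam (recr v0 zero (lam (lam v0)))

/-- Truncated subtraction. -/
def subC : Tm Γ (Ty.nat ⇾ Ty.nat ⇾ Ty.nat) := lam (lam (recr v0 v1 (lam (lam (predC ⬝ v1)))))
def sub (s t : Tm Γ Ty.nat) : Tm Γ Ty.nat := subC ⬝ s ⬝ t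

/-- Multiplication. -/
def mulC : Tm Γ (Ty.nat ⇾ Ty.nat ⇾ Ty.nat) :=
  lam (lam (recr v0 zero (lam (lam (add v1 v3)))))
def mul (s t : Tm Γ Ty.nat) : Tm Γ Ty.nat := mulC ⬝ s ⬝ t

/-- Powers of two. -/
def powC : Tm Γ Ty.one := lam (recr v0 (num 1) (lam (lam (add v1 v1))))

/-- Maximum and minimum of natural numbers. -/
def max (s t : Tm Γ Ty.nat) : Tm Γ Ty.nat := add s (sub t s)
def min (s t : Tm Γ Ty.nat) : Tm Γ Ty.nat := sub s (sub s t)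

/-- `quotC ⬝ x ⬝ k` is the integer part of `x / (k + 1)`: counting up to `x`, the quotient `q` is
increased by one at `i + 1` exactly if `(k + 1) * (q + 1) ≤ i + 1`. -/
def quotC : Tm Γ (Ty.nat ⇾ Ty.nat ⇾ Ty.nat) :=
  lam (lam (recr v1 zero
    (lam (lam (add v1 (sub (num 1) (sub (mul (suc v2) (suc v1)) (suc v0))))))))

/-- The functional taking `f` to `f̃`, where `f̃ n` is the maximum of `f k` for `k ≤ n`. -/
def tildeC : Tm Γ (Ty.one ⇾ Ty.one) :=
  lam (lam (recr v0 (v1 ⬝ zero) (lam (lam (max v1 (v3 ⬝ suc v0))))))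

/-! ### Real numbers

A function `γ` of type `1` represents, by signed digits, the real number
`γ 0 - γ 1 + ∑ i ≥ 1, (min (γ (i + 1)) 2 - 1) * 2 ^ (-i)`. -/

/-- The functional taking `γ` to the representation `γ_ℝ`: the entries with index at least two,
which code the digits `-1, 0, 1` as `0, 1, 2`, are cut off at two. -/
def repC : Tm Γ (Ty.one ⇾ Ty.one) :=
  lam (lam (recr v0 (v1 ⬝ zero) (lam (lam (recr v0 (v3 ⬝ num 1)
    (lam (lam (min (num 2) (v5 ⬝ suc (suc v0))))))))))

/-- The partial sum up to the `n`-th digit is `(posC γ n - negC γ n) / 2 ^ n`;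
it differs from the real number represented by `γ` by at most `1 / 2 ^ n`. -/
def posC : Tm Γ (Ty.one ⇾ Ty.one) :=
  lam (lam (recr v0 (repC ⬝ v1 ⬝ zero)
    (lam (lam (add (add v1 v1) (repC ⬝ v3 ⬝ suc (suc v0)))))))
def negC : Tm Γ (Ty.one ⇾ Ty.one) :=
  lam (lam (recr v0 (repC ⬝ v1 ⬝ num 1) (lam (lam (suc (add v1 v1))))))

/-- `mkC ⬝ p ⬝ q` is the representation with partial sums `(p n - q n) / 2 ^ n`, where the integers
`M n = p n - q n` satisfy `|M (n + 1) - 2 * M n| ≤ 1`. -/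
def mkC : Tm Γ (Ty.one ⇾ Ty.one ⇾ Ty.one) :=
  lam (lam (lam (recr v0 (sub (v2 ⬝ zero) (v1 ⬝ zero))
    (lam (lam (recr v0 (sub (v3 ⬝ zero) (v4 ⬝ zero))
      (lam (lam (sub (add (v6 ⬝ suc v0) (suc (add (v5 ⬝ v0) (v5 ⬝ v0))))
        (add (v5 ⬝ suc v0) (add (v6 ⬝ v0) (v6 ⬝ v0))))))))))))

/-- The real number given by a natural number. -/
def natRC : Tm Γ (Ty.nat ⇾ Ty.one) :=
  lam (lam (recr v0 v1 (lam (lam (recr v0 zero (lam (lam (num 1))))))))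

/-- The real number `1 / (k + 1)`, with partial sums `⌊2 ^ n / (k + 1)⌋ / 2 ^ n`. -/
def invRC : Tm Γ (Ty.nat ⇾ Ty.one) :=
  lam (mkC ⬝ lam (quotC ⬝ (powC ⬝ v0) ⬝ v1) ⬝ lam zero)

/-- Addition of real numbers, with partial sums `⌊(S + 2) / 4⌋ / 2 ^ n` where `S / 2 ^ (n + 2)` is
the sum of the partial sums of the summands. -/
def addRC : Tm Γ (Ty.one ⇾ Ty.one ⇾ Ty.one) :=
  lam (lam (mkC
    ⬝ lam (quotC ⬝ add
        (add (add (posC ⬝ v2 ⬝ suc (suc v0)) (posC ⬝ v1 ⬝ suc (suc v0)))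
          (mul (num 3) (add (negC ⬝ v2 ⬝ suc (suc v0)) (negC ⬝ v1 ⬝ suc (suc v0)))))
        (num 2) ⬝ num 3)
    ⬝ lam (add (negC ⬝ v2 ⬝ suc (suc v0)) (negC ⬝ v1 ⬝ suc (suc v0)))))

/-- Maximum and minimum of real numbers. -/
def maxRC : Tm Γ (Ty.one ⇾ Ty.one ⇾ Ty.one) :=
  lam (lam (mkC
    ⬝ lam (max (add (posC ⬝ v2 ⬝ v0) (negC ⬝ v1 ⬝ v0)) (add (posC ⬝ v1 ⬝ v0) (negC ⬝ v2 ⬝ v0)))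
    ⬝ lam (add (negC ⬝ v2 ⬝ v0) (negC ⬝ v1 ⬝ v0))))
def minRC : Tm Γ (Ty.one ⇾ Ty.one ⇾ Ty.one) :=
  lam (lam (mkC
    ⬝ lam (min (add (posC ⬝ v2 ⬝ v0) (negC ⬝ v1 ⬝ v0)) (add (posC ⬝ v1 ⬝ v0) (negC ⬝ v2 ⬝ v0)))
    ⬝ lam (add (negC ⬝ v2 ⬝ v0) (negC ⬝ v1 ⬝ v0))))

/-- The functional taking `γ` to `γ_[0,1] = max (0, min (1, γ))`. -/
def unitC : Tm Γ (Ty.one ⇾ Ty.one) :=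
  lam (maxRC ⬝ (natRC ⬝ zero) ⬝ (minRC ⬝ (natRC ⬝ num 1) ⬝ v0))

abbrev dist (x y : Tm Γ Ty.X) : Tm Γ Ty.one := .const .dist ⬝ x ⬝ y
abbrev natR (n : Tm Γ Ty.nat) : Tm Γ Ty.one := natRC ⬝ n
abbrev invR (k : Tm Γ Ty.nat) : Tm Γ Ty.one := invRC ⬝ k
abbrev addR (s t : Tm Γ Ty.one) : Tm Γ Ty.one := addRC ⬝ s ⬝ t

/-! ### Defined relations -/

/-- The relation `≤` of type `0`. -/
def le (s t : Tm Γ Ty.nat) : Fm Γ := sub s t ≐ zero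

/-- The `n`-th instance of `s ≤ t` for real numbers: the `n`-th partial sum of `s` exceeds that
of `t` by at most `2 / 2 ^ n`. -/
def leRAt (s t : Tm Γ Ty.one) (n : Tm Γ Ty.nat) : Fm Γ :=
  le (add (posC ⬝ s ⬝ n) (negC ⬝ t ⬝ n)) (add (add (posC ⬝ t ⬝ n) (negC ⬝ s ⬝ n)) (num 2))

/-- `s ≤ t` for real numbers. -/
def leR (s t : Tm Γ Ty.one) : Fm Γ := .all Ty.nat (leRAt s.wk t.wk v0)

/-- `s = t` for real numbers. -/
def eqR (s t : Tm Γ Ty.one) : Fm Γ :=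
  .all Ty.nat (leRAt s.wk t.wk v0 ⋏ leRAt t.wk s.wk v0)

/-- `s < t` for real numbers. -/
def ltR (s t : Tm Γ Ty.one) : Fm Γ := .ex Ty.nat (leRAt t.wk s.wk v0).neg

/-- Equality in the metric space is defined as `d(x, y) = 0`. -/
def eqX (x y : Tm Γ Ty.X) : Fm Γ := eqR (dist x y) (natR zero)

end Terms

/-- Equality of arbitrary type is defined pointwise. -/
def eqT : {Γ : List Ty} → (ρ : Ty) → Tm Γ ρ → Tm Γ ρ → Fm Γ
  | _, .nat, s, t => s ≐ t
  | _, .X, s, t => eqX s t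
  | _, .arr σ τ, s, t => .all σ (eqT τ (s.wk ⬝ v0) (t.wk ⬝ v0))

/-! ### Derivations -/

/-- A theory: a set of formulas (with parameters), the axioms. -/
abbrev Theory : Type := (Γ : List Ty) → Fm Γ → Prop

/-- Natural deduction for many-sorted classical predicate logic (with nonempty sorts), the axioms
of equality of type `0`, and the rule of weak extensionality for quantifier-free antecedents,
whose premise has to be derivable in the theory without open assumptions. -/
inductive Prf (T : Theory) : {Γ : List Ty} → List (Fm Γ) → Fm Γ → Prop
  | ax {Γ : List Ty} {H : List (Fm Γ)} {A : Fm Γ} : T Γ A → Prf T H A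
  | hyp {Γ : List Ty} {H : List (Fm Γ)} {A : Fm Γ} : A ∈ H → Prf T H A
  | impI {Γ : List Ty} {H : List (Fm Γ)} {A B : Fm Γ} : Prf T (A :: H) B → Prf T H (A ⟹ B)
  | impE {Γ : List Ty} {H : List (Fm Γ)} {A B : Fm Γ} :
      Prf T H (A ⟹ B) → Prf T H A → Prf T H B
  | andI {Γ : List Ty} {H : List (Fm Γ)} {A B : Fm Γ} :
      Prf T H A → Prf T H B → Prf T H (A ⋏ B)
  | andE₁ {Γ : List Ty} {H : List (Fm Γ)} {A B : Fm Γ} : Prf T H (A ⋏ B) → Prf T H A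
  | andE₂ {Γ : List Ty} {H : List (Fm Γ)} {A B : Fm Γ} : Prf T H (A ⋏ B) → Prf T H B
  | orI₁ {Γ : List Ty} {H : List (Fm Γ)} {A B : Fm Γ} : Prf T H A → Prf T H (.or A B)
  | orI₂ {Γ : List Ty} {H : List (Fm Γ)} {A B : Fm Γ} : Prf T H B → Prf T H (.or A B)
  | orE {Γ : List Ty} {H : List (Fm Γ)} {A B C : Fm Γ} :
      Prf T H (.or A B) → Prf T (A :: H) C → Prf T (B :: H) C → Prf T H C
  | raa {Γ : List Ty} {H : List (Fm Γ)} {A : Fm Γ} : Prf T (A.neg :: H) .bot → Prf T H A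
  | allI {Γ : List Ty} {H : List (Fm Γ)} {ρ : Ty} {A : Fm (ρ :: Γ)} :
      Prf T (H.map Fm.wk) A → Prf T H (.all ρ A)
  | allE {Γ : List Ty} {H : List (Fm Γ)} {ρ : Ty} {A : Fm (ρ :: Γ)} (t : Tm Γ ρ) :
      Prf T H (.all ρ A) → Prf T H (A.inst t)
  | exI {Γ : List Ty} {H : List (Fm Γ)} {ρ : Ty} {A : Fm (ρ :: Γ)} (t : Tm Γ ρ) :
      Prf T H (A.inst t) → Prf T H (.ex ρ A)
  | exE {Γ : List Ty} {H : List (Fm Γ)} {ρ : Ty} {A : Fm (ρ :: Γ)} {C : Fm Γ} :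
      Prf T H (.ex ρ A) → Prf T (A :: H.map Fm.wk) C.wk → Prf T H C
  | nonempty {Γ : List Ty} {H : List (Fm Γ)} (ρ : Ty) {A : Fm Γ} :
      Prf T (H.map (Fm.wk (σ := ρ))) A.wk → Prf T H A
  | eqRefl {Γ : List Ty} {H : List (Fm Γ)} (s : Tm Γ Ty.nat) : Prf T H (s ≐ s)
  | eqSymm {Γ : List Ty} {H : List (Fm Γ)} {s t : Tm Γ Ty.nat} :
      Prf T H (s ≐ t) → Prf T H (t ≐ s)
  | eqTrans {Γ : List Ty} {H : List (Fm Γ)} {s t r : Tm Γ Ty.nat} :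
      Prf T H (s ≐ t) → Prf T H (t ≐ r) → Prf T H (s ≐ r)
  | qfER {Γ : List Ty} {H : List (Fm Γ)} {A : Fm Γ} {ρ τ : Ty} {s t : Tm Γ ρ}
      (r : Tm (ρ :: Γ) τ) :
      A.QF → Prf T [] (A ⟹ eqT ρ s t) → Prf T H (A ⟹ eqT τ (r.inst s) (r.inst t))

/-- The theory `T` proves the sentence `A`. -/
def Theory.Proves (T : Theory) (A : Fm []) : Prop := Prf T [] A

/-! ### The theory of bounded metric spaces -/

/-- The axioms of `T_M`. -/
inductive TM : Theory
  | sucNeZero {Γ : List Ty} (s : Tm Γ Ty.nat) : TM Γ (suc s ≐ zero).neg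
  | sucInj {Γ : List Ty} (s t : Tm Γ Ty.nat) : TM Γ (suc s ≐ suc t ⟹ s ≐ t)
  | induction {Γ : List Ty} (A : Fm (Ty.nat :: Γ)) :
      TM Γ (A.inst zero ⋏ .all Ty.nat (A ⟹ A.subst (Sub.cons (suc v0) Sub.shift))
        ⟹ .all Ty.nat A)
  | comK {Γ : List Ty} {ρ τ : Ty} (s : Tm Γ ρ) (t : Tm Γ τ) : TM Γ (eqT ρ (comK ⬝ s ⬝ t) s)
  | comS {Γ : List Ty} {ρ σ τ : Ty} (s : Tm Γ (ρ ⇾ σ ⇾ τ)) (t : Tm Γ (ρ ⇾ σ)) (r : Tm Γ ρ) :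
      TM Γ (eqT τ (comS ⬝ s ⬝ t ⬝ r) (s ⬝ r ⬝ (t ⬝ r)))
  | recZero {Γ : List Ty} {ρ : Ty} (y : Tm Γ ρ) (z : Tm Γ (ρ ⇾ Ty.nat ⇾ ρ)) :
      TM Γ (eqT ρ (recr zero y z) y)
  | recSuc {Γ : List Ty} {ρ : Ty} (n : Tm Γ Ty.nat) (y : Tm Γ ρ) (z : Tm Γ (ρ ⇾ Ty.nat ⇾ ρ)) :
      TM Γ (eqT ρ (recr (suc n) y z) (z ⬝ recr n y z ⬝ n))
  | distRep {Γ : List Ty} (x y : Tm Γ Ty.X) (n : Tm Γ Ty.nat) :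
      TM Γ (dist x y ⬝ n ≐ repC ⬝ dist x y ⬝ n)
  | distSelf {Γ : List Ty} (x : Tm Γ Ty.X) : TM Γ (eqR (dist x x) (natR zero))
  | distComm {Γ : List Ty} (x y : Tm Γ Ty.X) : TM Γ (eqR (dist x y) (dist y x))
  | distTriangle {Γ : List Ty} (x y z : Tm Γ Ty.X) :
      TM Γ (leR (dist x z) (addR (dist x y) (dist y z)))
  | distBound {Γ : List Ty} (x y : Tm Γ Ty.X) : TM Γ (leR (dist x y) (natR (.const .bound)))

/-! ### The characteristic principles -/

/-- The substitution of `γ_[0,1]` for the last variable `γ`. -/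
def unitSub {Γ : List Ty} : Sub (Ty.one :: Γ) (Ty.one :: Γ) := Sub.cons (unitC ⬝ v0) Sub.shift

/-- `∀ k ≤ t, A` and `∃ k ≤ t, A`. -/
def allLe {Γ : List Ty} (t : Tm Γ Ty.nat) (A : Fm (Ty.nat :: Γ)) : Fm Γ :=
  .all Ty.nat (le v0 t.wk ⟹ A)
def exLe {Γ : List Ty} (t : Tm Γ Ty.nat) (A : Fm (Ty.nat :: Γ)) : Fm Γ :=
  .ex Ty.nat (le v0 t.wk ⋏ A)

/-- `∀ γ ∈ [0,1], A` and `∃ γ ∈ [0,1], A`. -/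
def allUnit {Γ : List Ty} (A : Fm (Ty.one :: Γ)) : Fm Γ := .all Ty.one (A.subst unitSub)
def exUnit {Γ : List Ty} (A : Fm (Ty.one :: Γ)) : Fm Γ := .ex Ty.one (A.subst unitSub)

/-- Bounded formulas. -/
inductive Fm.Bounded : {Γ : List Ty} → Fm Γ → Prop
  | eq {Γ : List Ty} (s t : Tm Γ Ty.nat) : Bounded (.eq s t)
  | bot {Γ : List Ty} : Bounded (.bot : Fm Γ)
  | and {Γ : List Ty} {A B : Fm Γ} : Bounded A → Bounded B → Bounded (.and A B)
  | or {Γ : List Ty} {A B : Fm Γ} : Bounded A → Bounded B → Bounded (.or A B)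
  | imp {Γ : List Ty} {A B : Fm Γ} : Bounded A → Bounded B → Bounded (.imp A B)
  | allLe {Γ : List Ty} (t : Tm Γ Ty.nat) {A : Fm (Ty.nat :: Γ)} :
      Bounded A → Bounded (allLe t A)
  | exLe {Γ : List Ty} (t : Tm Γ Ty.nat) {A : Fm (Ty.nat :: Γ)} : Bounded A → Bounded (exLe t A)
  | allX {Γ : List Ty} {A : Fm (Ty.X :: Γ)} : Bounded A → Bounded (.all Ty.X A)
  | exX {Γ : List Ty} {A : Fm (Ty.X :: Γ)} : Bounded A → Bounded (.ex Ty.X A)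
  | allUnit {Γ : List Ty} {A : Fm (Ty.one :: Γ)} : Bounded A → Bounded (allUnit A)
  | exUnit {Γ : List Ty} {A : Fm (Ty.one :: Γ)} : Bounded A → Bounded (exUnit A)

/-- `Σ`-formulas. -/
def Fm.IsSigma {Γ : List Ty} (A : Fm Γ) : Prop :=
  ∃ B : Fm (Ty.nat :: Γ), B.Bounded ∧ A = .ex Ty.nat B

/-- Bounded choice and the three bounded collection principles. In each case the last two variables
of `A` are the argument `i`, `γ`, `x` or `n` (the outer one) and the number `n` or `k` (the inner
one); the substitution `Sub.shift.lift.lift` only inserts an unused variable `f` or `n`. -/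
inductive CharPrinciple : Theory
  | bAC {Γ : List Ty} (A : Fm (Ty.nat :: Ty.nat :: Γ)) : A.IsSigma →
      CharPrinciple Γ (.all Ty.nat (.ex Ty.nat A) ⟹
        .ex Ty.one (.all Ty.nat (exLe (tildeC ⬝ v1 ⬝ v0) (A.subst Sub.shift.lift.lift))))
  | bCNat {Γ : List Ty} (m : Tm Γ Ty.nat) (A : Fm (Ty.nat :: Ty.nat :: Γ)) : A.IsSigma →
      CharPrinciple Γ (allLe m (.ex Ty.nat A) ⟹
        .ex Ty.nat (allLe m.wk (exLe v1 (A.subst Sub.shift.lift.lift))))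
  | bCUnit {Γ : List Ty} (A : Fm (Ty.nat :: Ty.one :: Γ)) : A.IsSigma →
      CharPrinciple Γ (allUnit (.ex Ty.nat A) ⟹
        .ex Ty.nat (allUnit (exLe v1 (A.subst Sub.shift.lift.lift))))
  | bCX {Γ : List Ty} (A : Fm (Ty.nat :: Ty.X :: Γ)) : A.IsSigma →
      CharPrinciple Γ (.all Ty.X (.ex Ty.nat A) ⟹
        .ex Ty.nat (.all Ty.X (exLe v1 (A.subst Sub.shift.lift.lift))))

/-- The theory `T_M⁺`: the theory `T_M` together with `bAC` and `bC`. -/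
def TMplus : Theory := fun Γ A => TM Γ A ∨ CharPrinciple Γ A

/-! ### The general principle -/

section Principle
variable {Γ : List Ty}

/-- `x` is a fixed point of `U`. -/
def isFix (U : Tm Γ (Ty.X ⇾ Ty.X)) (x : Tm Γ Ty.X) : Fm Γ := eqX (U ⬝ x) x

/-- `lim d(U(u n), u n) = 0`: for all `k` there is `N` with `d(U(u n), u n) ≤ 1 / (k + 1)` for all
`n ≥ N`. -/
def asympFix (U : Tm Γ (Ty.X ⇾ Ty.X)) (u : Tm Γ (Ty.nat ⇾ Ty.X)) : Fm Γ :=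
  .all Ty.nat (.ex Ty.nat (.all Ty.nat (le v1 v0 ⟹
    leR (dist (U.wk.wk.wk ⬝ (u.wk.wk.wk ⬝ v0)) (u.wk.wk.wk ⬝ v0)) (invR v2))))

/-- For all `k` there is `x ∈ Fix(U)` with `φ(x,x) < φ(x,y) + 1 / (k + 1)` for all `y ∈ Fix(U)`. -/
def fixHyp (U : Tm Γ (Ty.X ⇾ Ty.X)) (φ : Tm Γ (Ty.X ⇾ Ty.X ⇾ Ty.one)) : Fm Γ :=
  .all Ty.nat (.ex Ty.X (isFix U.wk.wk v0 ⋏ .all Ty.X (isFix U.wk.wk.wk v0 ⟹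
    ltR (φ.wk.wk.wk ⬝ v1 ⬝ v1) (addR (φ.wk.wk.wk ⬝ v1 ⬝ v0) (invR v2)))))

/-- For all `k` there are `x ∈ Fix(U)` and `n` with `φ(x,x) < φ(x,u m) + 1 / (k + 1)` for all
`m ≥ n`. -/
def fixConcl (U : Tm Γ (Ty.X ⇾ Ty.X)) (φ : Tm Γ (Ty.X ⇾ Ty.X ⇾ Ty.one))
    (u : Tm Γ (Ty.nat ⇾ Ty.X)) : Fm Γ :=
  .all Ty.nat (.ex Ty.X (isFix U.wk.wk v0 ⋏ .ex Ty.nat (.all Ty.nat (le v1 v0 ⟹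
    ltR (φ.wk.wk.wk.wk ⬝ v2 ⬝ v2)
      (addR (φ.wk.wk.wk.wk ⬝ v2 ⬝ (u.wk.wk.wk.wk ⬝ v0)) (invR v3))))))

end Principle

/-- The general principle, with `U`, `φ` and `u` quantified in this order. -/
def generalPrinciple : Fm [] :=
  .all (Ty.X ⇾ Ty.X) (.all (Ty.X ⇾ Ty.X ⇾ Ty.one) (.all (Ty.nat ⇾ Ty.X)
    (asympFix v2 v0 ⋏ fixHyp v2 v1 ⟹ fixConcl v2 v1 v0)))

/-- The closed unit ball of the Banach space `ℓ¹` of absolutely summable real sequences. -/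
abbrev UnitBall : Type := Metric.closedBall (0 : lp (fun _ : ℕ => ℝ) 1) 1

end BMS

namespace BMS

section Substitution

variable {Γ Δ Θ : List Ty} {ρ σ τ : Ty}

@[simp] theorem Tm.subst_var (f : Sub Γ Δ) (x : Var Γ ρ) : (Tm.var x).subst f = f ρ x := rfl
@[simp] theorem Tm.subst_const (f : Sub Γ Δ) (c : Const ρ) : (Tm.const c).subst f = .const c := rfl
@[simp] theorem Tm.subst_app (f : Sub Γ Δ) (s : Tm Γ (ρ ⇾ τ)) (t : Tm Γ ρ) :
    (s ⬝ t).subst f = s.subst f ⬝ t.subst f := rfl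
@[simp] theorem Sub.cons_zero (t : Tm Δ σ) (f : Sub Γ Δ) : Sub.cons t f σ .zero = t := rfl
@[simp] theorem Sub.cons_succ (t : Tm Δ σ) (f : Sub Γ Δ) (x : Var Γ ρ) :
    Sub.cons t f ρ (.succ x) = f ρ x := rfl
@[simp] theorem Sub.shift_apply (x : Var Γ ρ) :
    (Sub.shift : Sub Γ (σ :: Γ)) ρ x = .var x.succ := rfl
@[simp] theorem Sub.lift_zero (f : Sub Γ Δ) : (f.lift : Sub (σ :: Γ) (σ :: Δ)) σ .zero = v0 := rfl
@[simp] theorem Sub.lift_succ (f : Sub Γ Δ) (x : Var Γ ρ) :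
    (f.lift : Sub (σ :: Γ) (σ :: Δ)) ρ (.succ x) = (f ρ x).wk := rfl
@[simp] theorem Sub.single_zero (t : Tm Γ σ) : Sub.single t σ .zero = t := rfl
@[simp] theorem Sub.single_succ (t : Tm Γ σ) (x : Var Γ ρ) : Sub.single t ρ (.succ x) = .var x :=
  rfl

theorem Tm.subst_subst (f : Sub Γ Δ) (g : Sub Δ Θ) (t : Tm Γ ρ) :
    (t.subst f).subst g = t.subst (fun ρ x => (f ρ x).subst g) := by
  induction t with
  | var x => rfl
  | const c => rfl
  | app s t hs ht => simp [hs, ht]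

@[simp] theorem Tm.subst_id (t : Tm Γ ρ) : t.subst (fun _ x => .var x) = t := by
  induction t with
  | var x => rfl
  | const c => rfl
  | app s t hs ht => simp [hs, ht]

@[simp] theorem Tm.subst_shift (t : Tm Γ ρ) : t.subst (Sub.shift (σ := σ)) = t.wk := rfl

@[simp] theorem Tm.wk_subst_cons (t : Tm Γ ρ) (s : Tm Δ σ) (f : Sub Γ Δ) :
    t.wk.subst (Sub.cons s f) = t.subst f := subst_subst _ _ _

@[simp] theorem Tm.wk_subst_single (t : Tm Γ ρ) (s : Tm Γ σ) : t.wk.subst (Sub.single s) = t :=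
  (wk_subst_cons _ _ _).trans t.subst_id

@[simp] theorem Tm.wk_subst_lift (t : Tm Γ ρ) (f : Sub Γ Δ) :
    t.wk.subst (f.lift (σ := σ)) = (t.subst f).wk := by
  simp only [Tm.wk, subst_subst]; rfl

@[simp] theorem Tm.wk_var (x : Var Γ ρ) : (Tm.var x).wk (σ := σ) = .var x.succ := rfl
@[simp] theorem Tm.wk_const (c : Const ρ) :
    (Tm.const c : Tm Γ ρ).wk (σ := σ) = .const c := rfl
@[simp] theorem Tm.wk_app (s : Tm Γ (ρ ⇾ τ)) (t : Tm Γ ρ) :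
    (s ⬝ t).wk (σ := σ) = s.wk ⬝ t.wk := rfl

@[simp] theorem Tm.strengthen_wk (t : Tm Γ ρ) : (t.wk (σ := σ)).strengthen = some t := by
  induction t with
  | var x => rfl
  | const c => rfl
  | app s t hs ht => simp [strengthen, hs, ht]

theorem Tm.eq_wk_of_strengthen {t : Tm (σ :: Γ) ρ} {t' : Tm Γ ρ} (h : t.strengthen = some t') :
    t = t'.wk := by
  induction t with
  | var x =>
    cases x with
    | zero => simp [strengthen] at h
    | succ x => simp [strengthen] at h; simp [← h]
  | const c => simp [strengthen] at h; simp [← h]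
  | app s t hs ht =>
    cases h1 : s.strengthen <;> cases h2 : t.strengthen <;> simp [strengthen, h1, h2] at h
    simp [← h, hs h1, ht h2]

theorem Tm.strengthen_subst_lift (t : Tm (σ :: Γ) ρ) (f : Sub Γ Δ) :
    (t.subst f.lift).strengthen = t.strengthen.map (Tm.subst f) := by
  induction t with
  | var x =>
    cases x with
    | zero => rfl
    | succ x => simp [strengthen]
  | const c => rfl
  | app s t hs ht =>
    simp only [subst_app, strengthen, hs, ht]
    cases s.strengthen <;> cases t.strengthen <;> simp

theorem lam_wk (t : Tm Γ ρ) : lam (t.wk (σ := σ)) = comK ⬝ t := by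
  cases t <;> simp [lam]

@[simp] theorem subst_lam (t : Tm (σ :: Γ) ρ) (f : Sub Γ Δ) :
    (lam t).subst f = lam (t.subst f.lift) := by
  induction t with
  | var x =>
    cases x with
    | zero => rfl
    | succ x => simp [lam, lam_wk]
  | const c => rfl
  | app s t hs ht =>
    simp only [lam, Tm.subst_app, Tm.strengthen_subst_lift]
    cases s.strengthen <;> cases t.strengthen <;> simp [hs, ht]

@[simp] theorem wk_lam (t : Tm (σ :: Γ) ρ) :
    (lam t).wk (σ := τ) = lam (t.subst Sub.shift.lift) := subst_lam _ _

end Substitution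

/-! ### Maximal consistent sets -/

section Logic

variable {T : Theory} {Γ : List Ty} {ρ : Ty}

theorem Prf.weaken {H H' : List (Fm Γ)} {A : Fm Γ} (h : Prf T H A) (hH : H ⊆ H') :
    Prf T H' A := by
  induction h with
  | ax h => exact .ax h
  | hyp h => exact .hyp (hH h)
  | impI _ ih => exact .impI (ih (List.cons_subset_cons _ hH))
  | impE _ _ ih₁ ih₂ => exact .impE (ih₁ hH) (ih₂ hH)
  | andI _ _ ih₁ ih₂ => exact .andI (ih₁ hH) (ih₂ hH)
  | andE₁ _ ih => exact .andE₁ (ih hH)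
  | andE₂ _ ih => exact .andE₂ (ih hH)
  | orI₁ _ ih => exact .orI₁ (ih hH)
  | orI₂ _ ih => exact .orI₂ (ih hH)
  | orE _ _ _ ih ih₁ ih₂ =>
    exact .orE (ih hH) (ih₁ (List.cons_subset_cons _ hH)) (ih₂ (List.cons_subset_cons _ hH))
  | raa _ ih => exact .raa (ih (List.cons_subset_cons _ hH))
  | allI _ ih => exact .allI (ih (List.map_subset _ hH))
  | allE t _ ih => exact .allE t (ih hH)
  | exI t _ ih => exact .exI t (ih hH)
  | exE _ _ ih ih₁ =>
    exact .exE (ih hH) (ih₁ (List.cons_subset_cons _ (List.map_subset _ hH)))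
  | nonempty ρ _ ih => exact .nonempty ρ (ih (List.map_subset _ hH))
  | eqRefl s => exact .eqRefl s
  | eqSymm _ ih => exact .eqSymm (ih hH)
  | eqTrans _ _ ih₁ ih₂ => exact .eqTrans (ih₁ hH) (ih₂ hH)
  | qfER r hA h _ => exact .qfER r hA h

/-- Consistency of a set of formulas over a theory. -/
def Consistent (T : Theory) (C : Set (Fm Γ)) : Prop :=
  ∀ H : List (Fm Γ), (∀ A ∈ H, A ∈ C) → ¬ Prf T H .bot

theorem Consistent.prf_neg {C : Set (Fm Γ)} {A : Fm Γ} (h : ¬ Consistent T (insert A C)) :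
    ∃ H : List (Fm Γ), (∀ B ∈ H, B ∈ C) ∧ Prf T H A.neg := by
  classical
  simp only [Consistent, not_forall, not_not] at h
  obtain ⟨H, hH, hp⟩ := h
  refine ⟨H.filter (· ≠ A), fun B hB => ?_, .impI (hp.weaken fun B hB => ?_)⟩
  · rw [List.mem_filter] at hB
    exact (hH B hB.1).resolve_left (by simpa using hB.2)
  · by_cases hBA : B = A <;> simp [hB, hBA]

/-- Maximal consistent sets of formulas over a theory. -/
structure MCS (T : Theory) (Γ : List Ty) where
  carrier : Set (Fm Γ)
  consistent : Consistent T carrier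
  mem_or_neg_mem : ∀ A : Fm Γ, A ∈ carrier ∨ A.neg ∈ carrier

instance : Membership (Fm Γ) (MCS T Γ) := ⟨fun S A => A ∈ S.carrier⟩

theorem Consistent.exists_mcs {C : Set (Fm Γ)} (hC : Consistent T C) :
    ∃ S : MCS T Γ, ∀ A ∈ C, A ∈ S := by
  obtain ⟨M, hCM, hM⟩ := zorn_subset_nonempty {C : Set (Fm Γ) | Consistent T C}
    (by
      intro c hc hchain ⟨D, hD⟩
      refine ⟨⋃₀ c, fun H hH hp => ?_, fun s hs => Set.subset_sUnion_of_mem hs⟩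
      have key : ∀ H : List (Fm Γ), (∀ A ∈ H, A ∈ ⋃₀ c) → ∃ E ∈ c, ∀ A ∈ H, A ∈ E := by
        intro H
        induction H with
        | nil => exact fun _ => ⟨D, hD, by simp⟩
        | cons B H ih =>
          intro h
          obtain ⟨E, hE, hHE⟩ := ih fun A hA => h A (by simp [hA])
          obtain ⟨E', hE', hBE'⟩ := h B (by simp)
          rcases hchain.total hE hE' with hle | hle
          · exact ⟨E', hE', fun A hA => (List.mem_cons.1 hA).elim (· ▸ hBE') (hle <| hHE A ·)⟩
          · exact ⟨E, hE, fun A hA => (List.mem_cons.1 hA).elim (· ▸ hle hBE') (hHE A)⟩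
      obtain ⟨E, hE, hHE⟩ := key H hH
      exact hc hE H hHE hp) C hC
  have hins : ∀ A, A ∉ M → ¬ Consistent T (insert A M) := fun A hA hcon =>
    hA (hM.2 hcon (Set.subset_insert A M) (Set.mem_insert A M))
  refine ⟨⟨M, hM.1, fun A => ?_⟩, hCM⟩
  by_contra! h
  obtain ⟨H₁, hH₁, h₁⟩ := Consistent.prf_neg (hins _ h.1)
  obtain ⟨H₂, hH₂, h₂⟩ := Consistent.prf_neg (hins _ h.2)
  exact hM.1 (H₁ ++ H₂) (fun A hA => (List.mem_append.1 hA).elim (hH₁ A) (hH₂ A))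
    (.impE (h₂.weaken (by simp)) (h₁.weaken (by simp)))

namespace MCS

variable (S : MCS T Γ) {A B : Fm Γ}

variable {S} in
theorem mem_of_prf {H : List (Fm Γ)} (hp : Prf T H A) (hH : ∀ B ∈ H, B ∈ S) : A ∈ S := by
  refine (S.mem_or_neg_mem A).resolve_right fun hA => ?_
  exact S.consistent (A.neg :: H) (by simpa using ⟨hA, hH⟩)
    (.impE (.hyp (List.mem_cons_self (a := A.neg))) (hp.weaken (by simp)))

variable {S} in
theorem mem_of_prf_nil (hp : Prf T [] A) : A ∈ S := mem_of_prf hp (by simp)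

theorem bot_notMem : (.bot : Fm Γ) ∉ S := fun h =>
  S.consistent [.bot] (fun A hA => List.mem_singleton.1 hA ▸ h) (.hyp (by simp))

@[simp] theorem mem_imp : (A ⟹ B) ∈ S ↔ (A ∈ S → B ∈ S) := by
  refine ⟨fun h hA => mem_of_prf (H := [A ⟹ B, A]) (.impE (A := A) (.hyp (by simp)) (.hyp (by simp)))
    (by simp [h, hA]), fun h => ?_⟩
  rcases S.mem_or_neg_mem A with hA | hA
  · exact mem_of_prf (H := [B]) (.impI (.hyp (by simp))) (by simpa using h hA)
  · exact mem_of_prf (H := [A.neg]) (.impI (.raa (.impE (A := A) (.hyp (by simp [Fm.neg]))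
      (.hyp (by simp))))) (by simpa using show A.neg ∈ S from hA)

@[simp] theorem mem_neg : A.neg ∈ S ↔ A ∉ S := by
  simp [Fm.neg, bot_notMem]

@[simp] theorem mem_and : (A ⋏ B) ∈ S ↔ A ∈ S ∧ B ∈ S :=
  ⟨fun h => ⟨mem_of_prf (H := [A ⋏ B]) (.andE₁ (B := B) (.hyp (by simp))) (by simpa using h),
    mem_of_prf (H := [A ⋏ B]) (.andE₂ (A := A) (.hyp (by simp))) (by simpa using h)⟩,
    fun h => mem_of_prf (H := [A, B]) (.andI (.hyp (by simp)) (.hyp (by simp)))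
      (by simpa using h)⟩

theorem prf_of_forall_mcs {H : List (Fm Γ)}
    (h : ∀ S : MCS T Γ, (∀ B ∈ H, B ∈ S) → A ∈ S) : Prf T H A := by
  by_contra hp
  obtain ⟨S, hS⟩ := Consistent.exists_mcs (T := T) (C := {B | B ∈ A.neg :: H})
    (fun H' hH' hp' => hp (.raa (hp'.weaken hH')))
  exact S.mem_neg.1 (hS _ (by simp)) (h S fun B hB => hS _ (by simp [hB]))

variable {S} in
theorem inst_mem_of_all {A : Fm (ρ :: Γ)} (h : Fm.all ρ A ∈ S) (t : Tm Γ ρ) : A.inst t ∈ S :=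
  mem_of_prf (H := [Fm.all ρ A]) (.allE t (.hyp (by simp))) (by simpa using h)

variable {S} in
theorem ex_mem_of_inst {A : Fm (ρ :: Γ)} (t : Tm Γ ρ) (h : A.inst t ∈ S) : Fm.ex ρ A ∈ S :=
  mem_of_prf (H := [A.inst t]) (.exI t (.hyp (by simp))) (by simpa using h)

/-- `S'` extends `S` by a new variable. -/
def Ext (S : MCS T Γ) (S' : MCS T (ρ :: Γ)) : Prop := ∀ A ∈ S, A.wk ∈ S'

variable {S} in
theorem Ext.mem_wk {S' : MCS T (ρ :: Γ)} (h : S.Ext S') : A.wk ∈ S' ↔ A ∈ S := by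
  refine ⟨fun hA => (S.mem_or_neg_mem A).resolve_right fun hn => ?_, h A⟩
  exact S'.mem_neg.1 (h _ hn) hA

theorem exists_ext {A : Fm (ρ :: Γ)}
    (h : ∀ H : List (Fm Γ), (∀ B ∈ H, B ∈ S) → ¬ Prf T (H.map Fm.wk) A.neg) :
    ∃ S' : MCS T (ρ :: Γ), S.Ext S' ∧ A ∈ S' := by
  obtain ⟨S', hS'⟩ := Consistent.exists_mcs (T := T) (C := insert A (Fm.wk '' {B | B ∈ S})) (by
    by_contra hc
    obtain ⟨H, hH, hp⟩ := Consistent.prf_neg hc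
    have key : ∀ H : List (Fm (ρ :: Γ)), (∀ B ∈ H, B ∈ Fm.wk '' {B | B ∈ S}) →
        ∃ H' : List (Fm Γ), (∀ B ∈ H', B ∈ S) ∧ H = H'.map Fm.wk := by
      intro H
      induction H with
      | nil => exact fun _ => ⟨[], by simp⟩
      | cons B H ih =>
        intro h
        obtain ⟨H', hH', rfl⟩ := ih fun A hA => h A (by simp [hA])
        obtain ⟨B', hB', rfl⟩ := h B (by simp)
        exact ⟨B' :: H', by simpa using ⟨hB', hH'⟩, rfl⟩
    obtain ⟨H', hH', rfl⟩ := key H hH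
    exact h H' hH' hp)
  exact ⟨S', fun B hB => hS' _ (.inr ⟨B, hB, rfl⟩), hS' _ (.inl rfl)⟩

theorem all_mem {A : Fm (ρ :: Γ)} (h : ∀ S' : MCS T (ρ :: Γ), S.Ext S' → A ∈ S') :
    Fm.all ρ A ∈ S := by
  by_contra hA
  obtain ⟨S', hS', hn⟩ := S.exists_ext (A := A.neg) fun H hH hp => hA <|
    mem_of_prf (.allI (.raa (.impE (hp.weaken (by simp)) (.hyp (by simp))))) hH
  exact S'.mem_neg.1 hn (h S' hS')

variable {S} in
theorem exists_ext_of_ex {A : Fm (ρ :: Γ)} (h : Fm.ex ρ A ∈ S) :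
    ∃ S' : MCS T (ρ :: Γ), S.Ext S' ∧ A ∈ S' := by
  refine S.exists_ext fun H hH hp => S.bot_notMem ?_
  refine mem_of_prf (H := Fm.ex ρ A :: H) (.exE (ρ := ρ) (A := A) (.hyp (by simp)) ?_)
    (by simpa using ⟨h, hH⟩)
  exact .impE (A := A) (hp.weaken (by simp)) (.hyp (by simp))

end MCS

end Logic

section Constants

variable {Γ Δ : List Ty} {σ : Ty} (f : Sub Γ Δ)

@[simp] theorem subst_num (n : ℕ) : (num n).subst f = num n := by
  induction n with
  | zero => rfl
  | succ n ih => simp [num, ih]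
@[simp] theorem subst_addC : addC.subst f = addC := by simp [addC]
@[simp] theorem subst_add (s t : Tm Γ .nat) : (add s t).subst f = add (s.subst f) (t.subst f) := by
  simp [add]
@[simp] theorem subst_predC : predC.subst f = predC := by simp [predC]
@[simp] theorem subst_subC : subC.subst f = subC := by simp [subC]
@[simp] theorem subst_sub (s t : Tm Γ .nat) : (sub s t).subst f = sub (s.subst f) (t.subst f) := by
  simp [sub]
@[simp] theorem subst_mulC : mulC.subst f = mulC := by simp [mulC]
@[simp] theorem subst_mul (s t : Tm Γ .nat) : (mul s t).subst f = mul (s.subst f) (t.subst f) := by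
  simp [mul]
@[simp] theorem subst_powC : powC.subst f = powC := by simp [powC]
@[simp] theorem subst_min (s t : Tm Γ .nat) : (min s t).subst f = min (s.subst f) (t.subst f) := by
  simp [min]
@[simp] theorem subst_quotC : quotC.subst f = quotC := by simp [quotC]
@[simp] theorem subst_repC : repC.subst f = repC := by simp [repC]
@[simp] theorem subst_posC : posC.subst f = posC := by simp [posC]
@[simp] theorem subst_negC : negC.subst f = negC := by simp [negC]
@[simp] theorem subst_mkC : mkC.subst f = mkC := by simp [mkC]
@[simp] theorem subst_natRC : natRC.subst f = natRC := by simp [natRC]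
@[simp] theorem subst_invRC : invRC.subst f = invRC := by simp [invRC]
@[simp] theorem subst_addRC : addRC.subst f = addRC := by simp [addRC]

@[simp] theorem wk_num (n : ℕ) : (num n : Tm Γ .nat).wk (σ := σ) = num n := subst_num _ n
@[simp] theorem wk_powC : (powC : Tm Γ _).wk (σ := σ) = powC := subst_powC _
@[simp] theorem wk_quotC : (quotC : Tm Γ _).wk (σ := σ) = quotC := subst_quotC _
@[simp] theorem wk_repC : (repC : Tm Γ _).wk (σ := σ) = repC := subst_repC _
@[simp] theorem wk_posC : (posC : Tm Γ _).wk (σ := σ) = posC := subst_posC _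
@[simp] theorem wk_negC : (negC : Tm Γ _).wk (σ := σ) = negC := subst_negC _
@[simp] theorem wk_mkC : (mkC : Tm Γ _).wk (σ := σ) = mkC := subst_mkC _
@[simp] theorem wk_natRC : (natRC : Tm Γ _).wk (σ := σ) = natRC := subst_natRC _
@[simp] theorem wk_invRC : (invRC : Tm Γ _).wk (σ := σ) = invRC := subst_invRC _
@[simp] theorem wk_addRC : (addRC : Tm Γ _).wk (σ := σ) = addRC := subst_addRC _
@[simp] theorem wk_add (s t : Tm Γ .nat) : (add s t).wk (σ := σ) = add s.wk t.wk := subst_add _ s t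
@[simp] theorem wk_sub (s t : Tm Γ .nat) : (sub s t).wk (σ := σ) = sub s.wk t.wk := subst_sub _ s t
@[simp] theorem wk_mul (s t : Tm Γ .nat) : (mul s t).wk (σ := σ) = mul s.wk t.wk := subst_mul _ s t

@[simp] theorem subst_eq (s t : Tm Γ .nat) : (s ≐ t).subst f = (s.subst f ≐ t.subst f) := rfl
@[simp] theorem subst_imp (A B : Fm Γ) : (A ⟹ B).subst f = (A.subst f ⟹ B.subst f) := rfl
@[simp] theorem subst_neg (A : Fm Γ) : A.neg.subst f = (A.subst f).neg := rfl
@[simp] theorem subst_and (A B : Fm Γ) : (A ⋏ B).subst f = (A.subst f ⋏ B.subst f) := rfl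
@[simp] theorem subst_le (s t : Tm Γ .nat) : (le s t).subst f = le (s.subst f) (t.subst f) := by
  simp [le]
@[simp] theorem subst_leRAt (s t : Tm Γ .one) (n : Tm Γ .nat) :
    (leRAt s t n).subst f = leRAt (s.subst f) (t.subst f) (n.subst f) := by
  simp [leRAt]

end Constants

/-! ### Terms modulo provable equality -/

variable {Γ : List Ty} {ρ σ τ : Ty}

namespace MCS

/-- Leibniz equality of terms in a maximal consistent set. -/
def setoid (S : MCS TMplus Γ) (ρ : Ty) : Setoid (Tm Γ ρ) where
  r s t := ∀ r : Tm (ρ :: Γ) .nat, (r.inst s ≐ r.inst t) ∈ S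
  iseqv :=
    { refl := fun _ _ => mem_of_prf_nil (.eqRefl _)
      symm := fun {s t} h r => mem_of_prf (H := [r.inst s ≐ r.inst t])
        (.eqSymm (.hyp (by simp))) (by simpa using h r)
      trans := fun {s t u} h h' r => mem_of_prf (H := [r.inst s ≐ r.inst t, r.inst t ≐ r.inst u])
        (.eqTrans (t := r.inst t) (.hyp (by simp)) (.hyp (by simp))) (by simpa using ⟨h r, h' r⟩) }

/-- The terms of type `ρ` modulo Leibniz equality. -/
def Val (S : MCS TMplus Γ) (ρ : Ty) : Type := Quotient (S.setoid ρ)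

/-- The value of a term. -/
def val (S : MCS TMplus Γ) (t : Tm Γ ρ) : S.Val ρ := Quotient.mk (S.setoid ρ) t

variable {S : MCS TMplus Γ}

theorem val_surjective : Function.Surjective (S.val : Tm Γ ρ → S.Val ρ) := Quotient.exists_rep

theorem val_eq_iff {s t : Tm Γ ρ} :
    S.val s = S.val t ↔ ∀ r : Tm (ρ :: Γ) .nat, (r.inst s ≐ r.inst t) ∈ S :=
  Quotient.eq (r := S.setoid ρ)

theorem val_subst_single_congr {s t : Tm Γ ρ} (h : S.val s = S.val t) (r : Tm (ρ :: Γ) τ) :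
    S.val (r.subst (Sub.single s)) = S.val (r.subst (Sub.single t)) := by
  rw [val_eq_iff] at h ⊢
  intro q
  have key (u : Tm Γ ρ) :
      q.inst (r.subst (Sub.single u)) = (q.subst (Sub.cons r Sub.shift)).inst u := by
    simp only [Tm.inst, Tm.subst_subst]
    congr 1
    funext ρ x
    cases x <;> rfl
  rw [key, key]
  exact h _

/-- The value of an application. -/
def Val.app : S.Val (ρ ⇾ τ) → S.Val ρ → S.Val τ :=
  Quotient.map₂ (sa := S.setoid _) (sb := S.setoid _) (sc := S.setoid _) (· ⬝ ·)
    fun s s' hs t t' ht => by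
      have h₁ := val_subst_single_congr (val_eq_iff.2 (show ∀ r, _ ∈ S from hs)) (v0 ⬝ t.wk)
      have h₂ := val_subst_single_congr (val_eq_iff.2 (show ∀ r, _ ∈ S from ht)) (s'.wk ⬝ v0)
      simp only [Tm.subst_app, Tm.subst_var, Sub.single_zero, Tm.wk_subst_single] at h₁ h₂
      exact val_eq_iff.1 (h₁.trans h₂)

infixl:75 " ⋆ " => Val.app

@[simp] theorem val_app (s : Tm Γ (ρ ⇾ τ)) (t : Tm Γ ρ) : S.val (s ⬝ t) = S.val s ⋆ S.val t := rfl

theorem val_eq_of_prf {s t : Tm Γ ρ} {A : Fm Γ} (hA : A.QF) (h : Prf TMplus [] (A ⟹ eqT ρ s t))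
    (hAS : A ∈ S) : S.val s = S.val t :=
  val_eq_iff.2 fun r => S.mem_imp.1 (mem_of_prf_nil (.qfER (τ := .nat) r hA h)) hAS

theorem val_eq_of_ax {s t : Tm Γ ρ} (h : TM Γ (eqT ρ s t)) : S.val s = S.val t :=
  val_eq_of_prf (A := .bot ⟹ .bot) (.imp .bot .bot) (.impI (.ax (.inl h))) (by simp)

@[simp] theorem mem_eq {s t : Tm Γ .nat} : (s ≐ t) ∈ S ↔ S.val s = S.val t :=
  ⟨fun h => val_eq_of_prf (.eq s t) (.impI (.hyp (by simp [eqT]))) h,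
    fun h => val_eq_iff.1 h v0⟩

theorem comS_app (a : S.Val (ρ ⇾ σ ⇾ τ)) (b : S.Val (ρ ⇾ σ)) (c : S.Val ρ) :
    S.val comS ⋆ a ⋆ b ⋆ c = a ⋆ c ⋆ (b ⋆ c) := by
  obtain ⟨a, rfl⟩ := val_surjective a
  obtain ⟨b, rfl⟩ := val_surjective b
  obtain ⟨c, rfl⟩ := val_surjective c
  exact val_eq_of_ax (.comS a b c)

theorem comK_app (a : S.Val ρ) (b : S.Val τ) : S.val comK ⋆ a ⋆ b = a := by
  obtain ⟨a, rfl⟩ := val_surjective a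
  obtain ⟨b, rfl⟩ := val_surjective b
  exact val_eq_of_ax (.comK a b)

@[simp] theorem val_lam_app (t : Tm (σ :: Γ) τ) (s : Tm Γ σ) :
    S.val (lam t) ⋆ S.val s = S.val (t.subst (Sub.single s)) := by
  induction t with
  | var x =>
    cases x with
    | zero => simp [lam, comS_app, comK_app]
    | succ x => simp [lam, comK_app]
  | const c => simp [lam, comK_app]
  | app a b ha hb =>
    have h : S.val (comS ⬝ lam a ⬝ lam b ⬝ s) = S.val ((a ⬝ b).subst (Sub.single s)) := by
      simp [comS_app, ha, hb]
    simp only [lam]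
    cases h₁ : a.strengthen <;> cases h₂ : b.strengthen <;> try exact h
    simp [Tm.eq_wk_of_strengthen h₁, Tm.eq_wk_of_strengthen h₂, comK_app]

theorem val_recr_zero (y : Tm Γ ρ) (z : Tm Γ (ρ ⇾ .nat ⇾ ρ)) :
    S.val (recr zero y z) = S.val y :=
  val_eq_of_ax (.recZero y z)

theorem val_recr_suc {n : Tm Γ .nat} {y r : Tm Γ ρ} {t : Tm (.nat :: ρ :: Γ) ρ}
    (hr : S.val r = S.val (recr n y (lam (lam t)))) :
    S.val (recr (suc n) y (lam (lam t))) =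
      S.val ((t.subst (Sub.single r).lift).subst (Sub.single n)) := by
  rw [val_eq_of_ax (.recSuc n y (lam (lam t))), val_app, val_app, ← hr]
  simp

/-! ### Induction -/

theorem induction_mem (A : Fm (.nat :: Γ)) (h₀ : A.subst (Sub.single zero) ∈ S)
    (hs : ∀ S' : MCS TMplus (.nat :: Γ), S.Ext S' → A ∈ S' →
      A.subst (Sub.cons (suc v0) Sub.shift) ∈ S') (t : Tm Γ .nat) :
    A.subst (Sub.single t) ∈ S := by
  have h : _ ∈ S := mem_of_prf_nil (.ax (.inl (TM.induction A)))
  exact inst_mem_of_all (S.mem_imp.1 h (S.mem_and.2 ⟨h₀, S.all_mem fun S' hS' =>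
    S'.mem_imp.2 (hs S' hS')⟩)) t

theorem induction_eq (s t : Tm (.nat :: Γ) .nat)
    (h₀ : S.val (s.subst (Sub.single zero)) = S.val (t.subst (Sub.single zero)))
    (hs : ∀ S' : MCS TMplus (.nat :: Γ), S'.val s = S'.val t →
      S'.val (s.subst (Sub.cons (suc v0) Sub.shift)) =
        S'.val (t.subst (Sub.cons (suc v0) Sub.shift))) (r : Tm Γ .nat) :
    S.val (s.subst (Sub.single r)) = S.val (t.subst (Sub.single r)) := by
  have := induction_mem (S := S) (s ≐ t) (by simpa using h₀)
    (fun S' _ h => by simpa using hs S' (by simpa using h)) r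
  simpa using this

/-! ### The ordered monoid of numbers -/

namespace Val

instance : Zero (S.Val .nat) := ⟨S.val zero⟩
instance : Add (S.Val .nat) := ⟨fun a b => S.val addC ⋆ a ⋆ b⟩
instance : _root_.Sub (S.Val .nat) := ⟨fun a b => S.val subC ⋆ a ⋆ b⟩

/-- The successor of a number. -/
def succ (a : S.Val .nat) : S.Val .nat := S.val (.const .succ) ⋆ a

instance : One (S.Val .nat) := ⟨succ 0⟩

end Val

@[simp] theorem val_zero : S.val zero = 0 := rfl
theorem app_succ (a : S.Val .nat) : S.val (.const .succ) ⋆ a = a.succ := rfl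
@[simp] theorem val_add (s t : Tm Γ .nat) : S.val (add s t) = S.val s + S.val t := rfl
@[simp] theorem val_sub (s t : Tm Γ .nat) : S.val (sub s t) = S.val s - S.val t := rfl

namespace Val

variable (a b c : S.Val .nat)

theorem succ_ne_zero : a.succ ≠ 0 := by
  obtain ⟨a, rfl⟩ := val_surjective a
  have : _ ∈ S := mem_of_prf_nil (.ax (.inl (TM.sucNeZero a)))
  simpa [app_succ] using this

theorem val_add_eq (s t : Tm Γ .nat) :
    S.val s + S.val t = S.val (recr t s (lam (lam (suc v1)))) := by
  rw [← val_add]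
  simp [add, addC]

protected theorem add_zero : a + 0 = a := by
  obtain ⟨a, rfl⟩ := val_surjective a
  rw [← val_zero, val_add_eq, val_recr_zero]

theorem add_succ : a + b.succ = (a + b).succ := by
  obtain ⟨a, rfl⟩ := val_surjective a
  obtain ⟨b, rfl⟩ := val_surjective b
  rw [← app_succ, ← val_app, val_add_eq, val_recr_suc (r := add a b) (by rw [← val_add_eq, val_add])]
  simp [app_succ]

end Val

namespace Val

variable (a b c : S.Val .nat)

protected theorem zero_add : 0 + a = a := by
  obtain ⟨a, rfl⟩ := val_surjective a
  have := induction_eq (S := S) (add zero v0) v0 (by simp [Val.add_zero])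
    (fun S' h => by simp at h; simp [app_succ, add_succ, h]) a
  simpa using this

theorem succ_add : a.succ + b = (a + b).succ := by
  obtain ⟨a, rfl⟩ := val_surjective a
  obtain ⟨b, rfl⟩ := val_surjective b
  have := induction_eq (S := S) (add (suc a.wk) v0) (suc (add a.wk v0))
    (by simp [Val.add_zero, app_succ])
    (fun S' h => by simp [app_succ] at h; simp [app_succ, add_succ, h]) b
  simpa [app_succ] using this

protected theorem add_comm : a + b = b + a := by
  obtain ⟨a, rfl⟩ := val_surjective a
  obtain ⟨b, rfl⟩ := val_surjective b
  have := induction_eq (S := S) (add a.wk v0) (add v0 a.wk)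
    (by simp [Val.add_zero, Val.zero_add])
    (fun S' h => by simp at h; simp [app_succ, add_succ, succ_add, h]) b
  simpa using this

protected theorem add_assoc : a + b + c = a + (b + c) := by
  obtain ⟨a, rfl⟩ := val_surjective a
  obtain ⟨b, rfl⟩ := val_surjective b
  obtain ⟨c, rfl⟩ := val_surjective c
  have := induction_eq (S := S) (add (add a.wk b.wk) v0) (add a.wk (add b.wk v0))
    (by simp [Val.add_zero])
    (fun S' h => by simp at h; simp [app_succ, add_succ, h]) c
  simpa using this

instance : AddCommMonoid (S.Val .nat) where
  add_assoc := Val.add_assoc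
  zero_add := Val.zero_add
  add_zero := Val.add_zero
  add_comm := Val.add_comm
  nsmul := nsmulRec

theorem succ_eq : a.succ = a + 1 := by
  rw [show (1 : S.Val .nat) = succ 0 from rfl, add_succ, add_zero]

/-- The predecessor of a number. -/
def pred : S.Val .nat := S.val predC ⋆ a

theorem app_predC : S.val predC ⋆ a = a.pred := rfl

theorem val_pred_eq (t : Tm Γ .nat) :
    (S.val t).pred = S.val (recr t zero (lam (lam v0))) := by
  simp [pred, predC]

theorem pred_zero : (0 : S.Val .nat).pred = 0 := by
  rw [← val_zero, val_pred_eq, val_recr_zero]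

theorem pred_succ : a.succ.pred = a := by
  obtain ⟨a, rfl⟩ := val_surjective a
  rw [← app_succ, ← val_app, val_pred_eq,
    val_recr_suc (r := predC ⬝ a) (by rw [← val_pred_eq, val_app, pred])]
  simp

theorem eq_zero_or_eq_succ : a = 0 ∨ a = a.pred.succ := by
  obtain ⟨a, rfl⟩ := val_surjective a
  have := induction_mem (S := S) ((v0 ≐ zero).neg ⟹ v0 ≐ suc (predC ⬝ v0))
    (by simp)
    (fun S' _ h => by
      simp [app_succ, app_predC] at h
      simp [app_succ, app_predC, pred_succ]) a
  simp [app_succ, app_predC] at this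
  tauto

theorem val_sub_eq (s t : Tm Γ .nat) :
    S.val s - S.val t = S.val (recr t s (lam (lam (predC ⬝ v1)))) := by
  rw [← val_sub]
  simp [sub, subC]

protected theorem sub_zero : a - 0 = a := by
  obtain ⟨a, rfl⟩ := val_surjective a
  rw [← val_zero, val_sub_eq, val_recr_zero]

theorem sub_succ : a - b.succ = (a - b).pred := by
  obtain ⟨a, rfl⟩ := val_surjective a
  obtain ⟨b, rfl⟩ := val_surjective b
  rw [← app_succ, ← val_app, val_sub_eq, val_recr_suc (r := sub a b) (by rw [← val_sub_eq, val_sub])]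
  simp [pred]

theorem succ_sub_succ : a.succ - b.succ = a - b := by
  obtain ⟨a, rfl⟩ := val_surjective a
  obtain ⟨b, rfl⟩ := val_surjective b
  have := induction_eq (S := S) (sub (suc a.wk) (suc v0)) (sub a.wk v0)
    (by simp [app_succ, sub_succ, Val.sub_zero, pred_succ])
    (fun S' h => by
      simp [app_succ] at h
      simp [app_succ]
      rw [sub_succ, h, ← sub_succ]) b
  simpa [app_succ] using this

theorem add_sub_add_right : a + c - (b + c) = a - b := by
  obtain ⟨a, rfl⟩ := val_surjective a
  obtain ⟨b, rfl⟩ := val_surjective b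
  obtain ⟨c, rfl⟩ := val_surjective c
  have := induction_eq (S := S) (sub (add a.wk v0) (add b.wk v0)) (sub a.wk b.wk)
    (by simp)
    (fun S' h => by simp at h; simp [app_succ, add_succ, succ_sub_succ, h]) c
  simpa [app_succ] using this

protected theorem zero_sub : 0 - a = 0 := by
  obtain ⟨a, rfl⟩ := val_surjective a
  have := induction_eq (S := S) (sub zero v0) zero (by simp [Val.sub_zero])
    (fun S' h => by simp at h; simp [app_succ, sub_succ, h, pred_zero]) a
  simpa using this

protected theorem add_sub_cancel_right : a + b - b = a := by
  have := add_sub_add_right a 0 b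
  rwa [zero_add, Val.sub_zero] at this

theorem sub_add_self : b - (a + b) = 0 := by
  have := add_sub_add_right 0 a b
  rwa [zero_add, Val.zero_sub] at this

theorem eq_add_sub_or : a = b + (a - b) ∨ b = a + (b - a) := by
  obtain ⟨a, rfl⟩ := val_surjective a
  obtain ⟨b, rfl⟩ := val_surjective b
  have := induction_mem (S := S) ((v0 ≐ add b.wk (sub v0 b.wk)).neg ⟹
      b.wk ≐ add v0 (sub b.wk v0))
    (by simp [Val.sub_zero])
    (fun S' _ h => by
      simp at h
      simp [app_succ]
      intro h'
      by_cases h₁ : S'.val v0 = S'.val b.wk + (S'.val v0 - S'.val b.wk)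
      · refine absurd ?_ h'
        conv_lhs => rw [h₁, ← add_succ]
        generalize S'.val v0 - S'.val b.wk = c at h₁
        rw [h₁, ← add_succ, add_comm _ c.succ, Val.add_sub_cancel_right, add_comm]
      · specialize h h₁
        rcases eq_zero_or_eq_succ (S'.val b.wk - S'.val v0) with h₂ | h₂
        · rw [h₂, add_zero] at h
          rw [h] at h₁
          have h₃ := Val.add_sub_cancel_right 0 (S'.val v0)
          rw [zero_add] at h₃
          rw [h₃, add_zero] at h₁
          exact absurd rfl h₁
        · generalize (S'.val b.wk - S'.val v0).pred = c at h₂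
          rw [h₂] at h
          have h₃ : S'.val b.wk = c + (S'.val v0).succ := by rw [h, add_succ, add_comm, add_succ]
          rw [h₃, Val.add_sub_cancel_right, add_comm]) a
  simp at this
  tauto

theorem sub_eq_zero_iff : a - b = 0 ↔ ∃ c, b = a + c := by
  constructor
  · intro h
    rcases eq_add_sub_or a b with h' | h'
    · exact ⟨0, by rw [add_zero]; rw [h, add_zero] at h'; exact h'.symm⟩
    · exact ⟨_, h'⟩
  · rintro ⟨c, rfl⟩
    rw [add_comm, sub_add_self]

protected theorem add_right_cancel {a b c : S.Val .nat} (h : a + c = b + c) : a = b := by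
  rw [← Val.add_sub_cancel_right a c, h, Val.add_sub_cancel_right]

instance : IsCancelAdd (S.Val .nat) where
  add_left_cancel c a b h := Val.add_right_cancel (c := c) (by
    rw [add_comm a, add_comm b]; exact h)
  add_right_cancel _ _ _ h := Val.add_right_cancel h

theorem eq_zero_of_add_eq_zero (h : a + b = 0) : a = 0 := by
  rcases eq_zero_or_eq_succ a with h' | h'
  · exact h'
  · rw [h', succ_add] at h
    exact absurd h (succ_ne_zero _)

instance : LE (S.Val .nat) := ⟨fun a b => a - b = 0⟩

theorem le_iff : a ≤ b ↔ ∃ c, b = a + c := sub_eq_zero_iff a b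

open Classical in
noncomputable instance : LinearOrder (S.Val .nat) where
  le_refl a := (le_iff _ _).2 ⟨0, by simp⟩
  le_trans a b c h₁ h₂ := by
    obtain ⟨d, rfl⟩ := (le_iff _ _).1 h₁
    obtain ⟨e, rfl⟩ := (le_iff _ _).1 h₂
    exact (le_iff _ _).2 ⟨d + e, add_assoc _ _ _⟩
  le_antisymm a b h₁ h₂ := by
    obtain ⟨d, rfl⟩ := (le_iff _ _).1 h₁
    obtain ⟨e, he⟩ := (le_iff _ _).1 h₂
    rw [add_assoc, left_eq_add] at he
    rw [eq_zero_of_add_eq_zero _ _ he, add_zero]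
  le_total a b := by
    rcases eq_add_sub_or a b with h | h
    · exact .inr ((le_iff _ _).2 ⟨_, h⟩)
    · exact .inl ((le_iff _ _).2 ⟨_, h⟩)
  toDecidableLE := Classical.decRel _

instance : IsOrderedCancelAddMonoid (S.Val .nat) where
  add_le_add_left a b h c := by
    obtain ⟨d, rfl⟩ := (le_iff _ _).1 h
    exact (le_iff _ _).2 ⟨d, by abel⟩
  le_of_add_le_add_left a b c h := by
    obtain ⟨d, hd⟩ := (le_iff _ _).1 h
    exact (le_iff _ _).2 ⟨d, by rwa [add_assoc, add_left_cancel_iff] at hd⟩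

protected theorem zero_le : 0 ≤ a := (le_iff _ _).2 ⟨a, by simp⟩

theorem one_pos : (0 : S.Val .nat) < 1 :=
  lt_of_le_of_ne (Val.zero_le _) (succ_ne_zero _).symm

theorem add_one_le_of_lt {a b : S.Val .nat} (h : a < b) : a + 1 ≤ b := by
  obtain ⟨c, rfl⟩ := (le_iff _ _).1 h.le
  rcases eq_zero_or_eq_succ c with hc | hc
  · simp [hc] at h
  · rw [hc, succ_eq]
    exact (le_iff _ _).2 ⟨c.pred, by abel⟩

theorem sub_add_cancel_of_le {a b : S.Val .nat} (h : b ≤ a) : a - b + b = a := by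
  obtain ⟨c, rfl⟩ := (le_iff _ _).1 h
  rw [add_comm b c, Val.add_sub_cancel_right]

theorem sub_add_self_cases : a - b + b = a ∧ b ≤ a ∨ a - b = 0 ∧ a ≤ b := by
  rcases le_total a b with h | h
  · exact .inr ⟨h, h⟩
  · exact .inl ⟨sub_add_cancel_of_le h, h⟩

end Val

@[simp] theorem mem_le {s t : Tm Γ .nat} : le s t ∈ S ↔ S.val s ≤ S.val t := mem_eq

@[simp] theorem succ_app (a : S.Val .nat) : S.val (.const .succ) ⋆ a = a + 1 := Val.succ_eq a

theorem val_suc (t : Tm Γ .nat) : S.val (suc t) = S.val t + 1 :=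
  Val.succ_eq (S.val t)


namespace Val

/-! ### Defining equations of the closed terms -/

instance : Mul (S.Val .nat) := ⟨fun a b => S.val mulC ⋆ a ⋆ b⟩

end Val

@[simp] theorem val_mul (s t : Tm Γ .nat) : S.val (mul s t) = S.val s * S.val t := rfl

namespace Val

section Equations

variable (a b k n x : S.Val .nat) (γ δ p q : S.Val .one)

protected theorem mul_zero : a * 0 = 0 := by
  obtain ⟨a, rfl⟩ := val_surjective a
  have h (m : Tm Γ .nat) : S.val (mul a m) =
      S.val (recr m zero (lam (lam (add v1 a.wk.wk)))) := by simp [mul, mulC]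
  rw [← val_zero, ← val_mul, h, val_recr_zero]

protected theorem mul_succ : a * (b + 1) = a * b + a := by
  obtain ⟨a, rfl⟩ := val_surjective a
  obtain ⟨b, rfl⟩ := val_surjective b
  have h (m : Tm Γ .nat) : S.val (mul a m) =
      S.val (recr m zero (lam (lam (add v1 a.wk.wk)))) := by simp [mul, mulC]
  rw [← val_suc, ← val_mul, h, val_recr_suc (h b)]
  simp

theorem pow_succ : S.val powC ⋆ (n + 1) = S.val powC ⋆ n + S.val powC ⋆ n := by
  obtain ⟨n, rfl⟩ := val_surjective n
  have h (m : Tm Γ .nat) : S.val (powC ⬝ m) =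
      S.val (recr m (num 1) (lam (lam (add v1 v1)))) := by simp [powC]
  rw [← val_suc, ← val_app, h, val_recr_suc (h n)]
  simp

theorem val_quotC (x k : Tm Γ .nat) : S.val (quotC ⬝ x ⬝ k) = S.val (recr x zero
    (lam (lam (add v1 (sub (num 1) (sub (mul (suc k.wk.wk) (suc v1)) (suc v0))))))) := by
  simp [quotC]

theorem quot_zero : S.val quotC ⋆ 0 ⋆ k = 0 := by
  obtain ⟨k, rfl⟩ := val_surjective k
  rw [← val_zero, ← val_app, ← val_app, val_quotC, val_recr_zero]

theorem quot_succ : S.val quotC ⋆ (x + 1) ⋆ k = S.val quotC ⋆ x ⋆ k +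
    (1 - ((k + 1) * (S.val quotC ⋆ x ⋆ k + 1) - (x + 1))) := by
  obtain ⟨k, rfl⟩ := val_surjective k
  obtain ⟨x, rfl⟩ := val_surjective x
  rw [← val_suc x, ← val_app, ← val_app, val_quotC, val_recr_suc (val_quotC x k)]
  simp [num]

theorem val_repC (γ : Tm Γ .one) (n : Tm Γ .nat) : S.val (repC ⬝ γ ⬝ n) =
    S.val (recr n (γ ⬝ zero) (lam (lam (recr v0 (γ.wk.wk ⬝ num 1)
      (lam (lam (min (num 2) (γ.wk.wk.wk.wk ⬝ suc (suc v0))))))))) := by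
  simp [repC]

theorem rep_zero : S.val repC ⋆ γ ⋆ 0 = γ ⋆ 0 := by
  obtain ⟨γ, rfl⟩ := val_surjective γ
  rw [← val_zero, ← val_app, ← val_app, val_repC, val_recr_zero, val_app]

theorem rep_one : S.val repC ⋆ γ ⋆ 1 = γ ⋆ 1 := by
  obtain ⟨γ, rfl⟩ := val_surjective γ
  rw [show (1 : S.Val .nat) = S.val (suc zero) from rfl, ← val_app, ← val_app, val_repC,
    val_recr_suc (val_repC γ zero)]
  refine Eq.trans ?_ ((val_recr_zero (γ ⬝ num 1)
    (lam (lam (min (num 2) (γ.wk.wk ⬝ suc (suc v0)))))).trans ?_)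
  · simp
  · simp [num]

theorem rep_add_two : S.val repC ⋆ γ ⋆ (n + 1 + 1) = 1 + 1 - (1 + 1 - γ ⋆ (n + 1 + 1)) := by
  obtain ⟨γ, rfl⟩ := val_surjective γ
  obtain ⟨n, rfl⟩ := val_surjective n
  rw [← val_suc, ← val_suc, ← val_app, ← val_app, val_repC,
    val_recr_suc (val_repC γ (suc n))]
  refine Eq.trans ?_ ((val_recr_suc (n := n) (y := γ ⬝ num 1)
    (t := min (num 2) (γ.wk.wk ⬝ suc (suc v0))) rfl).trans ?_)
  · simp
  · simp [num, min]

theorem val_posC (γ : Tm Γ .one) (n : Tm Γ .nat) : S.val (posC ⬝ γ ⬝ n) =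
    S.val (recr n (repC ⬝ γ ⬝ zero)
      (lam (lam (add (add v1 v1) (repC ⬝ γ.wk.wk ⬝ suc (suc v0)))))) := by
  simp [posC]

theorem pos_zero : S.val posC ⋆ γ ⋆ 0 = γ ⋆ 0 := by
  rw [← rep_zero γ]
  obtain ⟨γ, rfl⟩ := val_surjective γ
  rw [← val_zero, ← val_app, ← val_app, val_posC, val_recr_zero]
  simp

theorem pos_succ : S.val posC ⋆ γ ⋆ (n + 1) =
    S.val posC ⋆ γ ⋆ n + S.val posC ⋆ γ ⋆ n + (1 + 1 - (1 + 1 - γ ⋆ (n + 1 + 1))) := by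
  rw [← rep_add_two n γ]
  obtain ⟨γ, rfl⟩ := val_surjective γ
  obtain ⟨n, rfl⟩ := val_surjective n
  rw [← val_suc, ← val_app, ← val_app, val_posC, val_recr_suc (val_posC γ n)]
  simp

theorem val_negC (γ : Tm Γ .one) (n : Tm Γ .nat) : S.val (negC ⬝ γ ⬝ n) =
    S.val (recr n (repC ⬝ γ ⬝ num 1) (lam (lam (suc (add v1 v1))))) := by
  simp [negC]

theorem neg_zero : S.val negC ⋆ γ ⋆ 0 = γ ⋆ 1 := by
  rw [← rep_one γ]
  obtain ⟨γ, rfl⟩ := val_surjective γ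
  rw [← val_zero, ← val_app, ← val_app, val_negC, val_recr_zero]
  simp [num]

theorem neg_succ : S.val negC ⋆ γ ⋆ (n + 1) = S.val negC ⋆ γ ⋆ n + S.val negC ⋆ γ ⋆ n + 1 := by
  obtain ⟨γ, rfl⟩ := val_surjective γ
  obtain ⟨n, rfl⟩ := val_surjective n
  rw [← val_suc, ← val_app, ← val_app, val_negC, val_recr_suc (val_negC γ n)]
  simp

theorem val_natRC (a n : Tm Γ .nat) : S.val (natRC ⬝ a ⬝ n) =
    S.val (recr n a (lam (lam (recr v0 zero (lam (lam (num 1))))))) := by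
  simp [natRC]

theorem natR_zero : S.val natRC ⋆ a ⋆ 0 = a := by
  obtain ⟨a, rfl⟩ := val_surjective a
  rw [← val_zero, ← val_app, ← val_app, val_natRC, val_recr_zero]

theorem natR_one : S.val natRC ⋆ a ⋆ 1 = 0 := by
  obtain ⟨a, rfl⟩ := val_surjective a
  rw [show (1 : S.Val .nat) = S.val (suc zero) from rfl, ← val_app, ← val_app, val_natRC,
    val_recr_suc (val_natRC a zero)]
  refine Eq.trans ?_ (val_recr_zero zero (lam (lam (num 1))))
  simp

theorem natR_add_two : S.val natRC ⋆ a ⋆ (n + 1 + 1) = 1 := by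
  obtain ⟨a, rfl⟩ := val_surjective a
  obtain ⟨n, rfl⟩ := val_surjective n
  rw [← val_suc, ← val_suc, ← val_app, ← val_app, val_natRC,
    val_recr_suc (val_natRC a (suc n))]
  refine Eq.trans ?_ ((val_recr_suc (n := n) (y := zero) (t := num 1) rfl).trans ?_)
  · simp
  · simp [num]

theorem val_mkC (p q : Tm Γ .one) (n : Tm Γ .nat) : S.val (mkC ⬝ p ⬝ q ⬝ n) =
    S.val (recr n (sub (p ⬝ zero) (q ⬝ zero))
      (lam (lam (recr v0 (sub (q.wk.wk ⬝ zero) (p.wk.wk ⬝ zero))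
        (lam (lam (sub (add (p.wk.wk.wk.wk ⬝ suc v0)
          (suc (add (q.wk.wk.wk.wk ⬝ v0) (q.wk.wk.wk.wk ⬝ v0))))
          (add (q.wk.wk.wk.wk ⬝ suc v0)
            (add (p.wk.wk.wk.wk ⬝ v0) (p.wk.wk.wk.wk ⬝ v0)))))))))) := by
  simp [mkC]

theorem mk_zero : S.val mkC ⋆ p ⋆ q ⋆ 0 = p ⋆ 0 - q ⋆ 0 := by
  obtain ⟨p, rfl⟩ := val_surjective p
  obtain ⟨q, rfl⟩ := val_surjective q
  rw [← val_zero, ← val_app, ← val_app, ← val_app, val_mkC, val_recr_zero]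
  simp

theorem mk_one : S.val mkC ⋆ p ⋆ q ⋆ 1 = q ⋆ 0 - p ⋆ 0 := by
  obtain ⟨p, rfl⟩ := val_surjective p
  obtain ⟨q, rfl⟩ := val_surjective q
  rw [show (1 : S.Val .nat) = S.val (suc zero) from rfl, ← val_app, ← val_app, ← val_app,
    val_mkC, val_recr_suc (val_mkC p q zero)]
  refine Eq.trans ?_ ((val_recr_zero (sub (q ⬝ zero) (p ⬝ zero))
    (lam (lam (sub (add (p.wk.wk ⬝ suc v0) (suc (add (q.wk.wk ⬝ v0) (q.wk.wk ⬝ v0))))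
          (add (q.wk.wk ⬝ suc v0) (add (p.wk.wk ⬝ v0) (p.wk.wk ⬝ v0))))))).trans ?_)
  · simp
  · simp

theorem mk_add_two : S.val mkC ⋆ p ⋆ q ⋆ (n + 1 + 1) =
    p ⋆ (n + 1) + (q ⋆ n + q ⋆ n + 1) - (q ⋆ (n + 1) + (p ⋆ n + p ⋆ n)) := by
  obtain ⟨p, rfl⟩ := val_surjective p
  obtain ⟨q, rfl⟩ := val_surjective q
  obtain ⟨n, rfl⟩ := val_surjective n
  rw [← val_suc, ← val_suc, ← val_app, ← val_app, ← val_app, val_mkC,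
    val_recr_suc (val_mkC p q (suc n))]
  refine Eq.trans ?_ ((val_recr_suc (n := n) (y := sub (q ⬝ zero) (p ⬝ zero))
    (t := sub (add (p.wk.wk ⬝ suc v0) (suc (add (q.wk.wk ⬝ v0) (q.wk.wk ⬝ v0))))
          (add (q.wk.wk ⬝ suc v0) (add (p.wk.wk ⬝ v0) (p.wk.wk ⬝ v0)))) rfl).trans ?_)
  · simp
  · simp

theorem invR_eq : ∃ p q : S.Val .one, S.val invRC ⋆ k = S.val mkC ⋆ p ⋆ q ∧
    (∀ n, p ⋆ n = S.val quotC ⋆ (S.val powC ⋆ n) ⋆ k) ∧ ∀ n, q ⋆ n = 0 := by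
  obtain ⟨k, rfl⟩ := val_surjective k
  refine ⟨S.val (lam (quotC ⬝ (powC ⬝ v0) ⬝ k.wk)), S.val (lam zero), ?_, fun n => ?_, fun n => ?_⟩
  · simp [invRC]
  · obtain ⟨n, rfl⟩ := val_surjective n
    simp
  · obtain ⟨n, rfl⟩ := val_surjective n
    simp

theorem addR_eq : ∃ p q : S.Val .one, S.val addRC ⋆ γ ⋆ δ = S.val mkC ⋆ p ⋆ q ∧
    (∀ n, p ⋆ n = S.val quotC ⋆
      (S.val posC ⋆ γ ⋆ (n + 1 + 1) + S.val posC ⋆ δ ⋆ (n + 1 + 1) +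
        S.val (num 3) * (S.val negC ⋆ γ ⋆ (n + 1 + 1) + S.val negC ⋆ δ ⋆ (n + 1 + 1)) +
          S.val (num 2)) ⋆ S.val (num 3)) ∧
    ∀ n, q ⋆ n = S.val negC ⋆ γ ⋆ (n + 1 + 1) + S.val negC ⋆ δ ⋆ (n + 1 + 1) := by
  obtain ⟨γ, rfl⟩ := val_surjective γ
  obtain ⟨δ, rfl⟩ := val_surjective δ
  refine ⟨S.val (lam (quotC ⬝ add (add (add (posC ⬝ γ.wk ⬝ suc (suc v0)) (posC ⬝ δ.wk ⬝ suc (suc v0)))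
    (mul (num 3) (add (negC ⬝ γ.wk ⬝ suc (suc v0)) (negC ⬝ δ.wk ⬝ suc (suc v0)))))
    (num 2) ⬝ num 3)), S.val (lam (add (negC ⬝ γ.wk ⬝ suc (suc v0)) (negC ⬝ δ.wk ⬝ suc (suc v0)))),
    ?_, fun n => ?_, fun n => ?_⟩
  · simp [addRC]
  · obtain ⟨n, rfl⟩ := val_surjective n
    simp
  · obtain ⟨n, rfl⟩ := val_surjective n
    simp

end Equations
end Val
end MCS
section
variable {Δ : List Ty}

/-- The first component of the representation `addR s t`. -/
def addRFst (s t : Tm Γ .one) (n : Tm Γ .nat) : Tm Γ .nat :=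
  quotC ⬝ add (add (add (posC ⬝ s ⬝ suc (suc n)) (posC ⬝ t ⬝ suc (suc n)))
    (mul (num 3) (add (negC ⬝ s ⬝ suc (suc n)) (negC ⬝ t ⬝ suc (suc n))))) (num 2) ⬝ num 3

/-- The second component of the representation `addR s t`. -/
def addRSnd (s t : Tm Γ .one) (n : Tm Γ .nat) : Tm Γ .nat :=
  add (negC ⬝ s ⬝ suc (suc n)) (negC ⬝ t ⬝ suc (suc n))

@[simp] theorem subst_addRFst (s t : Tm Γ .one) (n : Tm Γ .nat) (f : Sub Γ Δ) :
    (addRFst s t n).subst f = addRFst (s.subst f) (t.subst f) (n.subst f) := by simp [addRFst]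
@[simp] theorem subst_addRSnd (s t : Tm Γ .one) (n : Tm Γ .nat) (f : Sub Γ Δ) :
    (addRSnd s t n).subst f = addRSnd (s.subst f) (t.subst f) (n.subst f) := by simp [addRSnd]

end

namespace MCS

variable {S : MCS TMplus Γ}

namespace Val

variable (a b k n x : S.Val .nat) (γ δ p q : S.Val .one)

theorem one_add_one_sub_sub_le : 1 + 1 - (1 + 1 - a) ≤ a ∧ 1 + 1 - (1 + 1 - a) ≤ 1 + 1 := by
  have := Val.zero_le a
  have := one_pos (S := S)
  have := sub_add_self_cases (1 + 1) a
  have := sub_add_self_cases (1 + 1) (1 + 1 - a)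
  grind

theorem one_add_one_sub_sub_one : (1 + 1 - (1 + 1 - 1) : S.Val .nat) = 1 := by
  have := one_pos (S := S)
  have := sub_add_self_cases (S := S) (1 + 1) 1
  have := sub_add_self_cases (S := S) (1 + 1) (1 + 1 - 1)
  grind

theorem pow_le_pow {a b : S.Val .nat} (h : a ≤ b) : S.val powC ⋆ a ≤ S.val powC ⋆ b := by
  obtain ⟨c, rfl⟩ := (le_iff _ _).1 h
  obtain ⟨a, rfl⟩ := val_surjective a
  obtain ⟨c, rfl⟩ := val_surjective c
  have := induction_mem (S := S) (le (powC ⬝ a.wk) (powC ⬝ add a.wk v0)) (by simp)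
    (fun S' _ h => by
      simp at h
      simp [← add_assoc, pow_succ]
      have := Val.zero_le (S'.val powC ⋆ (S'.val a.wk + S'.val v0))
      grind) c
  simpa using this

theorem quot_eq_zero_of_le (h : x ≤ k) : S.val quotC ⋆ x ⋆ k = 0 := by
  obtain ⟨x, rfl⟩ := val_surjective x
  obtain ⟨k, rfl⟩ := val_surjective k
  have := induction_mem (S := S) (le v0 k.wk ⟹ quotC ⬝ v0 ⬝ k.wk ≐ zero) (by simp [quot_zero])
    (fun S' _ h => by
      simp at h
      simp
      intro h'
      have h₀ := one_pos (S := S')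
      specialize h (by grind)
      have h₁ := Val.mul_succ (S'.val k.wk + 1) 0
      rw [Val.mul_zero] at h₁
      rw [quot_succ, h, h₁]
      have := sub_add_self_cases (0 + (S'.val k.wk + 1)) (S'.val v0 + 1)
      have := sub_add_self_cases 1 (0 + (S'.val k.wk + 1) - (S'.val v0 + 1))
      have := @add_one_le_of_lt
      grind) x
  simp at this
  exact this h

theorem pos_invR_eq_neg (h : S.val powC ⋆ n ≤ k) :
    S.val posC ⋆ (S.val invRC ⋆ k) ⋆ n = S.val negC ⋆ (S.val invRC ⋆ k) ⋆ n := by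
  obtain ⟨n, rfl⟩ := val_surjective n
  obtain ⟨k, rfl⟩ := val_surjective k
  have := induction_mem (S := S) (le (powC ⬝ v0) k.wk ⟹
      posC ⬝ (invRC ⬝ k.wk) ⬝ v0 ≐ negC ⬝ (invRC ⬝ k.wk) ⬝ v0)
    (by
      simp
      intro h
      obtain ⟨p, q, hpq, hp, hq⟩ := invR_eq (S.val k)
      rw [pos_zero, neg_zero, hpq, mk_zero, mk_one, hp, hq, quot_eq_zero_of_le _ _ h])
    (fun S' _ h => by
      simp at h
      simp
      intro h'
      have h₁ : S'.val powC ⋆ S'.val v0 ≤ S'.val k.wk := by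
        rw [pow_succ] at h'
        have := Val.zero_le (S'.val powC ⋆ S'.val v0)
        grind
      obtain ⟨p, q, hpq, hp, hq⟩ := invR_eq (S'.val k.wk)
      have hd : S'.val invRC ⋆ S'.val k.wk ⋆ (S'.val v0 + 1 + 1) = 1 := by
        rw [hpq, mk_add_two, hp, hp, hq, hq, quot_eq_zero_of_le _ _ h', quot_eq_zero_of_le _ _ h₁]
        simp [Val.sub_zero]
      rw [pos_succ, neg_succ, h h₁, hd, one_add_one_sub_sub_one]) n
  simp at this
  exact this h

theorem pos_natR_zero : S.val posC ⋆ (S.val natRC ⋆ 0) ⋆ n = S.val negC ⋆ (S.val natRC ⋆ 0) ⋆ n := by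
  obtain ⟨n, rfl⟩ := val_surjective n
  have := induction_eq (S := S) (posC ⬝ (natRC ⬝ zero) ⬝ v0) (negC ⬝ (natRC ⬝ zero) ⬝ v0)
    (by simp [pos_zero, neg_zero, natR_zero, natR_one])
    (fun S' h => by
      simp at h
      simp [pos_succ, neg_succ, natR_add_two, one_add_one_sub_sub_one, h]) n
  simpa using this

theorem num_three_mul : S.val (num 3) * a = a + a + a := by
  obtain ⟨a, rfl⟩ := val_surjective a
  have := induction_eq (S := S) (mul (num 3) v0) (add (add v0 v0) v0) (by simp [Val.mul_zero])
    (fun S' h => by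
      simp at h
      simp [Val.mul_succ, h]
      simp [num]
      abel) a
  simpa using this

theorem num_three_add_one_mul : (S.val (num 3) + 1) * a = a + a + a + a := by
  obtain ⟨a, rfl⟩ := val_surjective a
  have := induction_eq (S := S) (mul (suc (num 3)) v0) (add (add (add v0 v0) v0) v0)
    (by simp [Val.mul_zero])
    (fun S' h => by
      simp at h
      simp [Val.mul_succ, h]
      simp [num]
      abel) a
  simpa using this

/-- The quotient by four. -/
theorem quot_num_three :
    let r := S.val quotC ⋆ x ⋆ S.val (num 3)
    r + r + r + r ≤ x ∧ x + 1 ≤ r + r + r + r + 1 + 1 + 1 + 1 := by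
  obtain ⟨x, rfl⟩ := val_surjective x
  let r : Tm (.nat :: Γ) .nat := quotC ⬝ v0 ⬝ num 3
  have := induction_mem (S := S) (le (add (add (add r r) r) r) v0 ⋏
      le (suc v0) (suc (suc (suc (suc (add (add (add r r) r) r))))))
    (by
      simp [r, quot_zero]
      have := one_pos (S := S)
      grind)
    (fun S' _ h => by
      simp [r] at h
      simp [r]
      rw [quot_succ, num_three_add_one_mul]
      generalize S'.val quotC ⋆ S'.val v0 ⋆ S'.val (num 3) = r at h
      generalize S'.val v0 = x at h
      have := one_pos (S := S')
      have := sub_add_self_cases (r + 1 + (r + 1) + (r + 1) + (r + 1)) (x + 1)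
      have := sub_add_self_cases 1 (r + 1 + (r + 1) + (r + 1) + (r + 1) - (x + 1))
      have := @add_one_le_of_lt
      grind) x
  simpa [r] using this

end Val

namespace Val

variable (n : S.Val .nat) (γ δ : S.Val .one)

theorem pos_succ_bounds :
    S.val posC ⋆ γ ⋆ n + S.val posC ⋆ γ ⋆ n ≤ S.val posC ⋆ γ ⋆ (n + 1) ∧
    S.val posC ⋆ γ ⋆ (n + 1) ≤ S.val posC ⋆ γ ⋆ n + S.val posC ⋆ γ ⋆ n + 1 + 1 := by
  have h := one_add_one_sub_sub_le (γ ⋆ (n + 1 + 1))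
  have := Val.zero_le (1 + 1 - (1 + 1 - γ ⋆ (n + 1 + 1)))
  rw [pos_succ]
  grind

/-- The partial sums of `addR` without the cutoff of the digits: they are the sums of the partial
sums of the summands, rounded to a quarter. -/
theorem addR_parts : ∃ p q : S.Val .one, S.val addRC ⋆ γ ⋆ δ = S.val mkC ⋆ p ⋆ q ∧
    (∀ n, p ⋆ n = S.val quotC ⋆
      (S.val posC ⋆ γ ⋆ (n + 1 + 1) + S.val posC ⋆ δ ⋆ (n + 1 + 1) +
        S.val (num 3) * (S.val negC ⋆ γ ⋆ (n + 1 + 1) + S.val negC ⋆ δ ⋆ (n + 1 + 1)) +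
          S.val (num 2)) ⋆ S.val (num 3)) ∧
    (∀ n, q ⋆ n = S.val negC ⋆ γ ⋆ (n + 1 + 1) + S.val negC ⋆ δ ⋆ (n + 1 + 1)) ∧
    (∀ n, p ⋆ n + p ⋆ n + p ⋆ n + p ⋆ n ≤
      S.val posC ⋆ γ ⋆ (n + 1 + 1) + S.val posC ⋆ δ ⋆ (n + 1 + 1) +
        (q ⋆ n + q ⋆ n + q ⋆ n) + (1 + 1)) ∧
    (∀ n, S.val posC ⋆ γ ⋆ (n + 1 + 1) + S.val posC ⋆ δ ⋆ (n + 1 + 1) +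
        (q ⋆ n + q ⋆ n + q ⋆ n) + (1 + 1) + 1 ≤ p ⋆ n + p ⋆ n + p ⋆ n + p ⋆ n + 1 + 1 + 1 + 1) := by
  obtain ⟨p, q, hpq, hp, hq⟩ := addR_eq γ δ
  have h2 : S.val (num 2) = 1 + 1 := by simp [num]
  have h (n) := quot_num_three (S.val posC ⋆ γ ⋆ (n + 1 + 1) + S.val posC ⋆ δ ⋆ (n + 1 + 1) +
        (q ⋆ n + q ⋆ n + q ⋆ n) + (1 + 1))
  have hp' (n) : p ⋆ n = _ := hp n
  simp only [← hq, num_three_mul, h2] at hp'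
  simp only [← hp'] at h
  exact ⟨p, q, hpq, hp, hq, fun n => (h n).1, fun n => (h n).2⟩

theorem addR_digit {p q : S.Val .one}
    (hq : ∀ n, q ⋆ n = S.val negC ⋆ γ ⋆ (n + 1 + 1) + S.val negC ⋆ δ ⋆ (n + 1 + 1))
    (h₁ : ∀ n, p ⋆ n + p ⋆ n + p ⋆ n + p ⋆ n ≤
      S.val posC ⋆ γ ⋆ (n + 1 + 1) + S.val posC ⋆ δ ⋆ (n + 1 + 1) +
        (q ⋆ n + q ⋆ n + q ⋆ n) + (1 + 1))
    (h₂ : ∀ n, S.val posC ⋆ γ ⋆ (n + 1 + 1) + S.val posC ⋆ δ ⋆ (n + 1 + 1) +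
        (q ⋆ n + q ⋆ n + q ⋆ n) + (1 + 1) + 1 ≤ p ⋆ n + p ⋆ n + p ⋆ n + p ⋆ n + 1 + 1 + 1 + 1) :
    q ⋆ (n + 1) + (p ⋆ n + p ⋆ n) ≤ p ⋆ (n + 1) + (q ⋆ n + q ⋆ n + 1) := by
  by_contra! hlt
  have h := add_one_le_of_lt hlt
  have hq₁ : q ⋆ (n + 1) = q ⋆ n + q ⋆ n + (1 + 1) := by
    rw [hq, hq, neg_succ, neg_succ _ δ]
    abel
  have h₃ := h₁ n
  have h₄ := h₂ (n + 1)
  have h₅ := (pos_succ_bounds (n + 1 + 1) γ).1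
  have h₆ := (pos_succ_bounds (n + 1 + 1) δ).1
  have := one_pos (S := S)
  rw [hq₁] at h h₄
  clear hlt h₁ h₂ hq hq₁
  grind

theorem pos_addR_le : ∃ p q : S.Val .nat,
    S.val posC ⋆ (S.val addRC ⋆ γ ⋆ δ) ⋆ n + q ≤ p + S.val negC ⋆ (S.val addRC ⋆ γ ⋆ δ) ⋆ n ∧
    q = S.val negC ⋆ γ ⋆ (n + 1 + 1) + S.val negC ⋆ δ ⋆ (n + 1 + 1) ∧
    p + p + p + p ≤ S.val posC ⋆ γ ⋆ (n + 1 + 1) + S.val posC ⋆ δ ⋆ (n + 1 + 1) +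
      (q + q + q) + (1 + 1) := by
  obtain ⟨s, rfl⟩ := val_surjective γ
  obtain ⟨t, rfl⟩ := val_surjective δ
  obtain ⟨n, rfl⟩ := val_surjective n
  have := induction_mem (S := S)
    (le (add (posC ⬝ addR s.wk t.wk ⬝ v0) (addRSnd s.wk t.wk v0))
      (add (addRFst s.wk t.wk v0) (negC ⬝ addR s.wk t.wk ⬝ v0)))
    (by
      obtain ⟨p, q, hpq, hp, hq, -, -⟩ := addR_parts (S.val s) (S.val t)
      have hp₀ := hp 0
      have hq₀ := hq 0
      rw [zero_add] at hp₀ hq₀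
      simp [addRFst, addRSnd]
      rw [← hp₀, ← hq₀, hpq, pos_zero, neg_zero, mk_zero, mk_one]
      have := sub_add_self_cases (p ⋆ 0) (q ⋆ 0)
      have := sub_add_self_cases (q ⋆ 0) (p ⋆ 0)
      grind)
    (fun S' _ h => by
      obtain ⟨p, q, hpq, hp, hq, h₁, h₂⟩ := addR_parts (S'.val s.wk) (S'.val t.wk)
      have hd := addR_digit (S'.val v0) _ _ hq h₁ h₂
      simp [addRFst, addRSnd] at h
      simp [addRFst, addRSnd]
      rw [← hp, ← hq, hpq] at h
      rw [← hp, ← hq, hpq, pos_succ, neg_succ, mk_add_two]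
      have h₃ := sub_add_cancel_of_le hd
      generalize p ⋆ (S'.val v0 + 1) + (q ⋆ S'.val v0 + q ⋆ S'.val v0 + 1) -
        (q ⋆ (S'.val v0 + 1) + (p ⋆ S'.val v0 + p ⋆ S'.val v0)) = d at h₃
      have h₄ := (one_add_one_sub_sub_le d).1
      clear hp hq h₁ h₂ hd hpq
      grind) n
  obtain ⟨p, q, -, hp, hq, h₁, h₂⟩ := addR_parts (S.val s) (S.val t)
  refine ⟨p ⋆ S.val n, q ⋆ S.val n, ?_, hq _, h₁ _⟩
  rw [hp, hq]
  simpa [addRFst, addRSnd] using this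

end Val

/-- Distances are nonnegative. -/
theorem leRAt_zero_dist (x y : Tm Γ .X) (n : Tm Γ .nat) :
    leRAt (natR zero) (dist x y) n ∈ S := by
  have hself : eqR (dist x x) (natR zero) ∈ S := mem_of_prf_nil (.ax (.inl (.distSelf x)))
  have htri : leR (dist x x) (addR (dist x y) (dist y x)) ∈ S :=
    mem_of_prf_nil (.ax (.inl (.distTriangle x y x)))
  have hcomm : eqR (dist x y) (dist y x) ∈ S := mem_of_prf_nil (.ax (.inl (.distComm x y)))
  have h₁ := inst_mem_of_all hself (suc n)
  have h₂ := inst_mem_of_all htri (suc n)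
  have h₃ := inst_mem_of_all hcomm (suc (suc (suc n)))
  simp [Fm.inst, leRAt] at h₁ h₂ h₃
  simp [leRAt]
  obtain ⟨p, q, h₄, rfl, h₅⟩ := Val.pos_addR_le (S.val n + 1) (S.val (dist x y)) (S.val (dist y x))
  have h2 : S.val (num 2) = 1 + 1 := by simp [num]
  simp only [val_app, h2, Val.pos_natR_zero] at *
  generalize S.val (.const .dist) ⋆ S.val x ⋆ S.val x = e at *
  generalize S.val (.const .dist) ⋆ S.val x ⋆ S.val y = a at *
  generalize S.val (.const .dist) ⋆ S.val y ⋆ S.val x = b at *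
  generalize S.val addRC ⋆ a ⋆ b = c at *
  generalize S.val n = n at *
  by_contra! hlt
  have h := Val.add_one_le_of_lt hlt
  have h₆ := (Val.pos_succ_bounds n a).2
  have h₇ := (Val.pos_succ_bounds (n + 1) a).2
  have h₈ := (Val.pos_succ_bounds (n + 1 + 1) a).2
  have h₉ := Val.neg_succ n a
  have h₁₀ := Val.neg_succ (n + 1) a
  have h₁₁ := Val.neg_succ (n + 1 + 1) a
  replace h₁ := h₁.2
  replace h₃ := h₃.2
  have := Val.one_pos (S := S)
  clear hlt hself htri hcomm
  grind
end MCS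
section

variable {Δ : List Ty} (f : Sub Γ Δ)

@[simp] theorem subst_all (A : Fm (ρ :: Γ)) : (Fm.all ρ A).subst f = .all ρ (A.subst f.lift) := rfl
@[simp] theorem subst_ex (A : Fm (ρ :: Γ)) : (Fm.ex ρ A).subst f = .ex ρ (A.subst f.lift) := rfl
@[simp] theorem subst_leR (s t : Tm Γ .one) :
    (leR s t).subst f = leR (s.subst f) (t.subst f) := by
  simp [leR]
@[simp] theorem subst_ltR (s t : Tm Γ .one) :
    (ltR s t).subst f = ltR (s.subst f) (t.subst f) := by
  simp [ltR]
@[simp] theorem subst_isFix (U : Tm Γ (.X ⇾ .X)) (x : Tm Γ .X) :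
    (isFix U x).subst f = isFix (U.subst f) (x.subst f) := by
  simp [isFix, eqX, eqR]
@[simp] theorem subst_exLe (t : Tm Γ .nat) (A : Fm (.nat :: Γ)) :
    (exLe t A).subst f = exLe (t.subst f) (A.subst f.lift) := by
  simp [exLe]
@[simp] theorem subst_asympFix (U : Tm Γ (.X ⇾ .X)) (u : Tm Γ (.nat ⇾ .X)) :
    (asympFix U u).subst f = asympFix (U.subst f) (u.subst f) := by
  simp [asympFix]
@[simp] theorem subst_fixHyp (U : Tm Γ (.X ⇾ .X)) (φ : Tm Γ (.X ⇾ .X ⇾ .one)) :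
    (fixHyp U φ).subst f = fixHyp (U.subst f) (φ.subst f) := by
  simp [fixHyp]

end

/-- The matrix of the `Σ`-formula to which collection over `X` is applied: if the `n`-th instance of
`U y = y` holds, then the `n`-th instance of `φ(x,y) + 1 / (k + 1) ≤ φ(x,x)` fails. -/
def fixMatrix {Γ : List Ty} (U : Tm Γ (.X ⇾ .X)) (φ : Tm Γ (.X ⇾ .X ⇾ .one)) (x : Tm Γ .X)
    (k : Tm Γ .nat) (y : Tm Γ .X) (n : Tm Γ .nat) : Fm Γ :=
  leRAt (dist (U ⬝ y) y) (natR zero) n ⋏ leRAt (natR zero) (dist (U ⬝ y) y) n ⟹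
    (leRAt (addR (φ ⬝ x ⬝ y) (invR k)) (φ ⬝ x ⬝ x) n).neg

theorem fixMatrix_bounded {Γ : List Ty} (U : Tm Γ (.X ⇾ .X)) (φ : Tm Γ (.X ⇾ .X ⇾ .one))
    (x : Tm Γ .X) (k : Tm Γ .nat) (y : Tm Γ .X) (n : Tm Γ .nat) :
    (fixMatrix U φ x k y n).Bounded :=
  .imp (.and (.eq _ _) (.eq _ _)) (.imp (.eq _ _) .bot)

@[simp] theorem subst_fixMatrix {Γ Δ : List Ty} (f : Sub Γ Δ) (U : Tm Γ (.X ⇾ .X))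
    (φ : Tm Γ (.X ⇾ .X ⇾ .one)) (x : Tm Γ .X) (k : Tm Γ .nat) (y : Tm Γ .X) (n : Tm Γ .nat) :
    (fixMatrix U φ x k y n).subst f = fixMatrix (U.subst f) (φ.subst f) (x.subst f) (k.subst f)
      (y.subst f) (n.subst f) := by
  simp [fixMatrix]

namespace MCS

variable {S : MCS TMplus Γ}

theorem leRAt_zero_of_leRAt_inv {d : Tm Γ .one} {N n : Tm Γ .nat}
    (h : leRAt d (invR (powC ⬝ N)) n ∈ S) (hn : le n N ∈ S) : leRAt d (natR zero) n ∈ S := by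
  simp [leRAt] at h hn ⊢
  rw [Val.pos_invR_eq_neg _ _ (Val.pow_le_pow hn)] at h
  rw [Val.pos_natR_zero]
  grind

theorem exists_fixMatrix_mem (U : Tm Γ (.X ⇾ .X)) (φ : Tm Γ (.X ⇾ .X ⇾ .one)) (x : Tm Γ .X)
    (k : Tm Γ .nat) (y : Tm Γ .X)
    (h : isFix U y ∈ S → ltR (φ ⬝ x ⬝ x) (addR (φ ⬝ x ⬝ y) (invR k)) ∈ S) :
    Fm.ex .nat (fixMatrix U.wk φ.wk x.wk k.wk y.wk v0) ∈ S := by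
  by_cases hy : isFix U y ∈ S
  · obtain ⟨S', hS', hm⟩ := exists_ext_of_ex (h hy)
    refine hS'.mem_wk.1 (ex_mem_of_inst v0 ?_)
    rw [mem_neg] at hm
    simp only [Fm.inst, subst_fixMatrix, Tm.wk_subst_lift, Tm.wk_subst_single,
      Tm.subst_shift, Tm.subst_var, Sub.lift_zero, Sub.single_zero]
    simp only [fixMatrix, mem_imp, mem_neg]
    simp only [Tm.wk_app, wk_addRC, wk_invRC] at hm
    exact fun _ => hm
  · by_contra hex
    refine hy (S.all_mem fun S' hS' => ?_)
    by_contra hm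
    refine hex (hS'.mem_wk.1 (ex_mem_of_inst v0 ?_))
    simp only [Fm.inst, subst_fixMatrix, Tm.wk_subst_lift, Tm.wk_subst_single,
      Tm.subst_shift, Tm.subst_var, Sub.lift_zero, Sub.single_zero]
    simp only [fixMatrix, mem_imp]
    simp only [Tm.wk_app, Tm.wk_const, wk_natRC] at hm
    exact fun hm' => absurd hm' hm

theorem exists_bound_fixMatrix (U : Tm Γ (.X ⇾ .X)) (φ : Tm Γ (.X ⇾ .X ⇾ .one)) (x : Tm Γ .X)
    (k : Tm Γ .nat)
    (h : Fm.all .X (isFix U.wk v0 ⟹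
      ltR (φ.wk ⬝ x.wk ⬝ x.wk) (addR (φ.wk ⬝ x.wk ⬝ v0) (invR k.wk))) ∈ S) :
    Fm.ex .nat (.all .X (exLe v1 (.ex .nat (fixMatrix U.wk.wk.wk.wk φ.wk.wk.wk.wk x.wk.wk.wk.wk
      k.wk.wk.wk.wk v2 v1)))) ∈ S := by
  have hc : _ ∈ S := mem_of_prf_nil (.ax (.inr (CharPrinciple.bCX
    (.ex .nat (fixMatrix U.wk.wk.wk φ.wk.wk.wk x.wk.wk.wk k.wk.wk.wk v2 v1))
      ⟨_, fixMatrix_bounded _ _ _ _ _ _, rfl⟩)))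
  rw [mem_imp] at hc
  simpa using hc (S.all_mem fun S' hS' => by
    have := exists_fixMatrix_mem (S := S') U.wk φ.wk x.wk k.wk v0 (by
      have := inst_mem_of_all (hS' _ h) v0
      simpa [Fm.inst] using this)
    obtain ⟨S'', hS'', hm⟩ := exists_ext_of_ex this
    refine hS''.mem_wk.1 (ex_mem_of_inst v0 (ex_mem_of_inst zero ?_))
    simpa [Fm.inst, Fm.wk] using hm)

theorem ltR_mem (U : Tm Γ (.X ⇾ .X)) (φ : Tm Γ (.X ⇾ .X ⇾ .one)) (x : Tm Γ .X)
    (k : Tm Γ .nat) (y : Tm Γ .X) (N : Tm Γ .nat)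
    (h : leR (dist (U ⬝ y) y) (invR (powC ⬝ N)) ∈ S)
    (hN : exLe N (.ex .nat (fixMatrix U.wk.wk φ.wk.wk x.wk.wk k.wk.wk y.wk.wk v1)) ∈ S) :
    ltR (φ ⬝ x ⬝ x) (addR (φ ⬝ x ⬝ y) (invR k)) ∈ S := by
  obtain ⟨S₁, hS₁, hn⟩ := exists_ext_of_ex hN
  rw [mem_and] at hn
  obtain ⟨S₂, hS₂, hm⟩ := exists_ext_of_ex hn.2
  replace hm : fixMatrix U.wk φ.wk x.wk k.wk y.wk v0 ∈ S₁ := hS₂.mem_wk.1 (by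
    simpa only [Fm.wk, subst_fixMatrix, Tm.subst_shift, Tm.wk_var] using hm)
  have h₁ := inst_mem_of_all (hS₁ _ h) v0
  refine hS₁.mem_wk.1 (ex_mem_of_inst v0 ?_)
  simp only [fixMatrix, mem_imp, mem_and] at hm
  simp [Fm.inst, -mem_neg] at h₁ ⊢
  exact hm ⟨leRAt_zero_of_leRAt_inv h₁ hn.1, leRAt_zero_dist _ _ _⟩

theorem fixConcl_mem (U : Tm Γ (.X ⇾ .X)) (φ : Tm Γ (.X ⇾ .X ⇾ .one)) (u : Tm Γ (.nat ⇾ .X))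
    (hu : asympFix U u ∈ S) (hφ : fixHyp U φ ∈ S) : fixConcl U φ u ∈ S := by
  refine S.all_mem fun S₁ hS₁ => ?_
  obtain ⟨S₂, hS₂, hx⟩ := exists_ext_of_ex (inst_mem_of_all (hS₁ _ hφ) v0)
  refine hS₂.mem_wk.1 (ex_mem_of_inst v0 ?_)
  simp [Fm.inst] at hx ⊢
  refine ⟨hx.1, ?_⟩
  obtain ⟨S₃, hS₃, hN⟩ := exists_ext_of_ex (exists_bound_fixMatrix U.wk.wk φ.wk.wk v0 v1 hx.2)
  have hu₃ := hS₃ _ (hS₂ _ (hS₁ _ hu))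
  simp only [Fm.wk, subst_asympFix] at hu₃
  obtain ⟨S₄, hS₄, hn⟩ := exists_ext_of_ex (inst_mem_of_all hu₃ (powC ⬝ v0))
  refine hS₃.mem_wk.1 (hS₄.mem_wk.1 (ex_mem_of_inst v0 (S₄.all_mem fun S₅ hS₅ => ?_)))
  have hn₅ := inst_mem_of_all (hS₅ _ hn) v0
  have hN₅ := inst_mem_of_all (hS₅ _ (hS₄ _ hN)) (u.wk.wk.wk.wk.wk ⬝ v0)
  simp [Fm.inst, -mem_le] at hn₅ hN₅ ⊢
  exact fun hm => ltR_mem U.wk.wk.wk.wk.wk φ.wk.wk.wk.wk.wk v3 v4 (u.wk.wk.wk.wk.wk ⬝ v0) v2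
    (hn₅ hm) hN₅

theorem proves_generalPrinciple : TMplus.Proves generalPrinciple := by
  refine .allI (.allI (.allI (prf_of_forall_mcs fun S _ => ?_)))
  rw [mem_imp, mem_and]
  exact fun h => fixConcl_mem _ _ _ h.1 h.2

end MCS
theorem norm_diag_entry_mul_le (i : ℕ) (r : ℝ) : ‖(1 - 1 / ((i : ℝ) + 2)) * r‖ ≤ ‖r‖ := by
  rw [norm_mul]
  refine mul_le_of_le_one_left (norm_nonneg _) ?_
  have h : 1 / ((i : ℝ) + 2) ≤ 1 := by
    rw [div_le_one (by positivity)]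
    linarith [(Nat.cast_nonneg i : (0 : ℝ) ≤ i)]
  have h' : 0 ≤ 1 / ((i : ℝ) + 2) := by positivity
  rw [Real.norm_eq_abs, abs_le]
  constructor <;> linarith

/-- The diagonal operator on `ℓ¹` with the entries `(i + 1) / (i + 2)`. -/
noncomputable def diag (x : lp (fun _ : ℕ => ℝ) 1) : lp (fun _ : ℕ => ℝ) 1 :=
  ⟨fun i => (1 - 1 / ((i : ℝ) + 2)) * x i,
    (lp.memℓp x).mono' fun i => norm_diag_entry_mul_le i (x i)⟩

theorem diag_apply (x : lp (fun _ : ℕ => ℝ) 1) (i : ℕ) :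
    diag x i = (1 - 1 / ((i : ℝ) + 2)) * x i := rfl

theorem diag_sub (x y : lp (fun _ : ℕ => ℝ) 1) : diag (x - y) = diag x - diag y := by
  ext i
  simp only [diag_apply, lp.coeFn_sub, Pi.sub_apply]
  ring

theorem norm_diag_le (x : lp (fun _ : ℕ => ℝ) 1) : ‖diag x‖ ≤ ‖x‖ :=
  lp.norm_mono one_ne_zero fun i => norm_diag_entry_mul_le i (x i)

theorem continuous_diag : Continuous diag :=
  LipschitzWith.continuous (K := 1) <| LipschitzWith.of_dist_le_mul fun x y => by
    rw [dist_eq_norm, dist_eq_norm, ← diag_sub, NNReal.coe_one, one_mul]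
    exact norm_diag_le _

theorem eq_zero_of_diag_eq {x : lp (fun _ : ℕ => ℝ) 1} (h : diag x = x) : x = 0 := by
  ext i
  have hi : (1 - 1 / ((i : ℝ) + 2)) * x i = x i := by rw [← diag_apply, h]
  have h₂ : (1 / ((i : ℝ) + 2)) * x i = 0 := by linarith
  exact (mul_eq_zero.1 h₂).resolve_left (by positivity)

theorem diag_single_sub (n : ℕ) :
    diag (lp.single 1 n 1) - lp.single 1 n 1 = lp.single 1 n (-(1 / ((n : ℝ) + 2))) := by
  ext i
  rw [lp.coeFn_sub, Pi.sub_apply, diag_apply]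
  by_cases h : i = n
  · subst h
    simp only [lp.single_apply_self]
    ring
  · simp only [lp.single_apply_ne _ _ _ h, mul_zero, sub_zero]

theorem exists_unitBall_counterexample :
    ∃ (U : UnitBall → UnitBall) (φ : UnitBall → UnitBall → ℝ) (u : ℕ → UnitBall),
      Continuous U ∧ Continuous (fun z : UnitBall × UnitBall => φ z.1 z.2) ∧
      (∃ B : ℝ, ∀ x y, |φ x y| ≤ B) ∧
      Filter.Tendsto (fun n => Dist.dist (U (u n)) (u n)) Filter.atTop (nhds 0) ∧
      (∀ k : ℕ, ∃ x, U x = x ∧ ∀ y, U y = y → φ x x < φ x y + 1 / ((k : ℝ) + 1)) ∧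
      ¬ ∀ k : ℕ, ∃ x, U x = x ∧ ∃ n : ℕ, ∀ m ≥ n, φ x x < φ x (u m) + 1 / ((k : ℝ) + 1) := by
  have hfix {x : UnitBall} (h : diag x.1 = x.1) : x.1 = 0 := eq_zero_of_diag_eq h
  have hsingle (n : ℕ) : ‖(lp.single 1 n 1 : lp (fun _ : ℕ => ℝ) 1)‖ = 1 := by
    rw [lp.norm_single one_pos, norm_one]
  refine ⟨fun x => ⟨diag x.1, mem_closedBall_zero_iff.2
      ((norm_diag_le _).trans (mem_closedBall_zero_iff.1 x.2))⟩, fun _ y => -‖y.1‖,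
    fun n => ⟨lp.single 1 n 1, mem_closedBall_zero_iff.2 (hsingle n).le⟩, ?_, ?_, ⟨1, ?_⟩, ?_,
    ?_, ?_⟩
  · exact (continuous_diag.comp continuous_subtype_val).subtype_mk _
  · fun_prop
  · intro _ y
    rw [abs_neg, abs_norm]
    exact mem_closedBall_zero_iff.1 y.2
  · have h (n : ℕ) : ‖(lp.single 1 n (-(1 / ((n : ℝ) + 2))) : lp (fun _ : ℕ => ℝ) 1)‖ =
        1 / ((n : ℝ) + 2) := by
      rw [lp.norm_single one_pos, norm_neg, Real.norm_of_nonneg (by positivity)]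
    simp only [Subtype.dist_eq, dist_eq_norm, diag_single_sub, h]
    refine squeeze_zero (fun n => by positivity) (fun n => ?_)
      (tendsto_one_div_add_atTop_nhds_zero_nat (𝕜 := ℝ))
    gcongr
    norm_num
  · intro k
    have h₀ : diag (0 : lp (fun _ : ℕ => ℝ) 1) = 0 :=
      norm_le_zero_iff.1 ((norm_diag_le 0).trans norm_zero.le)
    refine ⟨⟨0, by simp⟩, Subtype.ext h₀, fun y hy => ?_⟩
    change -‖(0 : lp (fun _ : ℕ => ℝ) 1)‖ < -‖y.1‖ + 1 / ((k : ℝ) + 1)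
    rw [hfix (congrArg Subtype.val hy)]
    have : (0 : ℝ) < 1 / ((k : ℝ) + 1) := by positivity
    linarith
  · intro h
    obtain ⟨x, hx, n, hn⟩ := h 0
    have : -‖x.1‖ < -‖(lp.single 1 n 1 : lp (fun _ : ℕ => ℝ) 1)‖ + 1 / (((0 : ℕ) : ℝ) + 1) :=
      hn n le_rfl
    rw [hfix (congrArg Subtype.val hx), hsingle] at this
    norm_num at this

end BMS

theorem proposition4p2 :
    BMS.TMplus.Proves BMS.generalPrinciple ∧
    ∃ (U : BMS.UnitBall → BMS.UnitBall) (φ : BMS.UnitBall → BMS.UnitBall → ℝ)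
      (u : ℕ → BMS.UnitBall),
      Continuous U ∧ Continuous (fun z : BMS.UnitBall × BMS.UnitBall => φ z.1 z.2) ∧
      (∃ B : ℝ, ∀ x y, |φ x y| ≤ B) ∧
      Filter.Tendsto (fun n => dist (U (u n)) (u n)) Filter.atTop (nhds 0) ∧
      (∀ k : ℕ, ∃ x, U x = x ∧ ∀ y, U y = y → φ x x < φ x y + 1 / ((k : ℝ) + 1)) ∧
      ¬ ∀ k : ℕ, ∃ x, U x = x ∧ ∃ n : ℕ, ∀ m ≥ n, φ x x < φ x (u m) + 1 / ((k : ℝ) + 1) :=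
  ⟨BMS.MCS.proves_generalPrinciple, BMS.exists_unitBall_counterexample⟩
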